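/- Let $n\ge 1$ and let $(M,J,g)$ be a connected Vaisman manifold of real dimension $2n+2$ with Lee form of unit length. That is, $M$ is a connected smooth manifold, $J$ is an integrable almost complex structure on $M$, $g$ is a Riemannian metric with $g(JX,JY)=g(X,Y)$, with fundamental form $\omega(X,Y)=g(X,JY)$, and $\theta$ is a $1$-form that is parallel for the Levi-Civita connection of $g$ and satisfies $d\omega=\theta\wedge\omega$ and $\|\theta\|_g=1$. Let $\theta^c=\theta\circ J$. Suppose that the Ricci tensor of $g$ has the form $$\operatorname{Ric}=\lambda\, g+\alpha\,\theta^c\otimes\theta^c+\beta\,\theta\otimes\theta$$ with smooth functions $\lambda,\alpha,\beta\in C^\infty(M)$. Then $\lambda+\alpha=\frac n2$ and $\beta=-\lambda$ on $M$. If moreover $n\ge 3$, then the functions $\lambda$ and $\alpha$ are constant. -/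

import Mathlib

open scoped Manifold ContDiff
open Bundle

noncomputable section

/-- The model vector space `ℝ^m`. -/
abbrev Eucl (m : ℕ) : Type := EuclideanSpace ℝ (Fin m)

/-! ### Tensor calculus on open subsets of `ℝ^m`

`G`, `J`, `θ`, `Om` are the coordinate expressions of a metric, an endomorphism field, a one-form
and a two-form; vectors `u v w` stand for the coordinate vector fields with constant components. -/

namespace Coord

variable {m : ℕ}

/-- The Christoffel map `Γ_y(u, v) = ∇_u v` of the Levi-Civita connection of the metric `G`:
`G(Γ(u, v), w) = ½ (∂_u G(v, w) + ∂_v G(u, w) - ∂_w G(u, v))`. -/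
def christoffel (G : Eucl m → Eucl m →L[ℝ] Eucl m →L[ℝ] ℝ) (y u v : Eucl m) : Eucl m :=
  (G y).inverse ((1 / 2 : ℝ) •
    (fderiv ℝ G y u v + fderiv ℝ G y v u - ((fderiv ℝ G y).flip u).flip v))

/-- The Riemann curvature tensor `R(u, v)w = ∇_u ∇_v w - ∇_v ∇_u w` for coordinate fields
`u, v, w`, whose Lie brackets vanish. -/
def riemann (G : Eucl m → Eucl m →L[ℝ] Eucl m →L[ℝ] ℝ) (y u v w : Eucl m) : Eucl m :=
  fderiv ℝ (fun z => christoffel G z v w) y u - fderiv ℝ (fun z => christoffel G z u w) y v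
    + christoffel G y u (christoffel G y v w) - christoffel G y v (christoffel G y u w)

/-- The Ricci tensor `Ric(v, w)`, the trace of `u ↦ R(u, v)w`. -/
def ricci (G : Eucl m → Eucl m →L[ℝ] Eucl m →L[ℝ] ℝ) (y v w : Eucl m) : ℝ :=
  ∑ i : Fin m, riemann G y (EuclideanSpace.single i 1) v w i

/-- The covariant derivative `(∇_u θ)(v) = ∂_u (θ(v)) - θ(∇_u v)` of a one-form. -/
def covDerivOneForm (G : Eucl m → Eucl m →L[ℝ] Eucl m →L[ℝ] ℝ) (θ : Eucl m → Eucl m →L[ℝ] ℝ)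
    (y u v : Eucl m) : ℝ :=
  fderiv ℝ θ y u v - θ y (christoffel G y u v)

/-- The exterior derivative of a two-form. -/
def extDerivTwoForm (Om : Eucl m → Eucl m →L[ℝ] Eucl m →L[ℝ] ℝ) (y u v w : Eucl m) : ℝ :=
  fderiv ℝ Om y u v w + fderiv ℝ Om y v w u + fderiv ℝ Om y w u v

/-- The wedge product of a one-form and a two-form. -/
def wedgeOneTwo (θ : Eucl m → Eucl m →L[ℝ] ℝ) (Om : Eucl m → Eucl m →L[ℝ] Eucl m →L[ℝ] ℝ)
    (y u v w : Eucl m) : ℝ :=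
  θ y u * Om y v w + θ y v * Om y w u + θ y w * Om y u v

/-- The Nijenhuis tensor `N(u, v) = [Ju, Jv] - J[Ju, v] - J[u, Jv] - [u, v]`, where `[u, v] = 0`
for coordinate fields. -/
def nijenhuis (J : Eucl m → Eucl m →L[ℝ] Eucl m) (y u v : Eucl m) : Eucl m :=
  VectorField.lieBracket ℝ (fun z => J z u) (fun z => J z v) y
    - J y (VectorField.lieBracket ℝ (fun z => J z u) (fun _ => v) y)
    - J y (VectorField.lieBracket ℝ (fun _ => u) (fun z => J z v) y)

end Coord

/-! ### Coordinate expressions of tensor fields on a manifold -/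

section Manifold

variable {m : ℕ} {M : Type*} [TopologicalSpace M] [ChartedSpace (Eucl m) M]

/-- The differential at `y` of the inverse of the chart `e`; it sends a constant vector to the
corresponding coordinate vector field. -/
def chartFrame (e : OpenPartialHomeomorph M (Eucl m)) (y : Eucl m) :
    Eucl m →L[ℝ] TangentSpace 𝓘(ℝ, Eucl m) (e.symm y) :=
  mfderiv 𝓘(ℝ, Eucl m) 𝓘(ℝ, Eucl m) e.symm y

/-- The differential of the chart `e` at the point with coordinates `y`. -/
def chartCoframe (e : OpenPartialHomeomorph M (Eucl m)) (y : Eucl m) :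
    TangentSpace 𝓘(ℝ, Eucl m) (e.symm y) →L[ℝ] Eucl m :=
  mfderiv 𝓘(ℝ, Eucl m) 𝓘(ℝ, Eucl m) e (e.symm y)

/-- The expression of a one-form in the chart `e`. -/
def oneFormInChart (θ : ∀ x : M, TangentSpace 𝓘(ℝ, Eucl m) x →L[ℝ] ℝ)
    (e : OpenPartialHomeomorph M (Eucl m)) (y : Eucl m) : Eucl m →L[ℝ] ℝ :=
  (θ (e.symm y)).comp (chartFrame e y)

/-- The expression of a field of bilinear forms in the chart `e`. -/
def bilinInChart
    (b : ∀ x : M, TangentSpace 𝓘(ℝ, Eucl m) x →L[ℝ] TangentSpace 𝓘(ℝ, Eucl m) x →L[ℝ] ℝ)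
    (e : OpenPartialHomeomorph M (Eucl m)) (y : Eucl m) : Eucl m →L[ℝ] Eucl m →L[ℝ] ℝ :=
  let bx : Eucl m →L[ℝ] Eucl m →L[ℝ] ℝ := b (e.symm y)
  let A : Eucl m →L[ℝ] Eucl m := chartFrame e y
  bx.bilinearComp A A

/-- The expression of an endomorphism field in the chart `e`. -/
def endoInChart
    (J : ∀ x : M, TangentSpace 𝓘(ℝ, Eucl m) x →L[ℝ] TangentSpace 𝓘(ℝ, Eucl m) x)
    (e : OpenPartialHomeomorph M (Eucl m)) (y : Eucl m) : Eucl m →L[ℝ] Eucl m :=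
  (chartCoframe e y).comp ((J (e.symm y)).comp (chartFrame e y))

/-- The fundamental two-form `ω(u, v) = g(u, Jv)`. -/
def fundamentalForm
    (g : ∀ x : M, TangentSpace 𝓘(ℝ, Eucl m) x →L[ℝ] TangentSpace 𝓘(ℝ, Eucl m) x →L[ℝ] ℝ)
    (J : ∀ x : M, TangentSpace 𝓘(ℝ, Eucl m) x →L[ℝ] TangentSpace 𝓘(ℝ, Eucl m) x) (x : M) :
    TangentSpace 𝓘(ℝ, Eucl m) x →L[ℝ] TangentSpace 𝓘(ℝ, Eucl m) x →L[ℝ] ℝ :=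
  let gx : Eucl m →L[ℝ] Eucl m →L[ℝ] ℝ := g x
  let Jx : Eucl m →L[ℝ] Eucl m := J x
  gx.bilinearComp (ContinuousLinearMap.id ℝ (Eucl m)) Jx

/-- The anti-Lee form `θᶜ = θ ∘ J`. -/
def antiLeeForm (J : ∀ x : M, TangentSpace 𝓘(ℝ, Eucl m) x →L[ℝ] TangentSpace 𝓘(ℝ, Eucl m) x)
    (θ : ∀ x : M, TangentSpace 𝓘(ℝ, Eucl m) x →L[ℝ] ℝ) (x : M) :
    TangentSpace 𝓘(ℝ, Eucl m) x →L[ℝ] ℝ :=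
  (θ x).comp (J x)

variable [IsManifold 𝓘(ℝ, Eucl m) ∞ M]

/-- `(M, J, g)` is a Vaisman manifold whose Lee form `θ` is normalized by `‖θ‖ = 1`. Tensor
identities that involve derivatives are required in every smooth chart. -/
structure IsNormalizedVaisman
    (g : ContMDiffRiemannianMetric 𝓘(ℝ, Eucl m) ∞ (Eucl m)
      (TangentSpace 𝓘(ℝ, Eucl m) : M → Type))
    (J : ∀ x : M, TangentSpace 𝓘(ℝ, Eucl m) x →L[ℝ] TangentSpace 𝓘(ℝ, Eucl m) x)
    (θ : ∀ x : M, TangentSpace 𝓘(ℝ, Eucl m) x →L[ℝ] ℝ) : Prop where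
  /-- `J` is smooth. -/
  smooth_J : ContMDiff 𝓘(ℝ, Eucl m) (𝓘(ℝ, Eucl m).prod 𝓘(ℝ, Eucl m →L[ℝ] Eucl m)) ∞
    (fun x => TotalSpace.mk' (Eucl m →L[ℝ] Eucl m)
      (E := fun x : M => TangentSpace 𝓘(ℝ, Eucl m) x →L[ℝ] TangentSpace 𝓘(ℝ, Eucl m) x) x (J x))
  /-- `J` is an almost complex structure. -/
  J_sq : ∀ (x : M) (u : TangentSpace 𝓘(ℝ, Eucl m) x), J x (J x u) = -u
  /-- `J` is integrable: its Nijenhuis tensor vanishes. -/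
  integrable : ∀ e ∈ IsManifold.maximalAtlas 𝓘(ℝ, Eucl m) ∞ M, ∀ y ∈ e.target, ∀ u v : Eucl m,
    Coord.nijenhuis (endoInChart J e) y u v = 0
  /-- `g` is a Hermitian metric. -/
  hermitian : ∀ (x : M) (u v : TangentSpace 𝓘(ℝ, Eucl m) x),
    g.inner x (J x u) (J x v) = g.inner x u v
  /-- `θ` is smooth. -/
  smooth_θ : ContMDiff 𝓘(ℝ, Eucl m) (𝓘(ℝ, Eucl m).prod 𝓘(ℝ, Eucl m →L[ℝ] ℝ)) ∞
    (fun x => TotalSpace.mk' (Eucl m →L[ℝ] ℝ)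
      (E := fun x : M => TangentSpace 𝓘(ℝ, Eucl m) x →L[ℝ] Bundle.Trivial M ℝ x) x (θ x))
  /-- `‖θ‖ = 1`: the vector `U` that is `g`-dual to `θ` has length one. -/
  norm_θ : ∀ x : M, ∃ U : TangentSpace 𝓘(ℝ, Eucl m) x,
    (∀ v, θ x v = g.inner x U v) ∧ g.inner x U U = 1
  /-- `θ` is parallel for the Levi-Civita connection of `g`. -/
  parallel : ∀ e ∈ IsManifold.maximalAtlas 𝓘(ℝ, Eucl m) ∞ M, ∀ y ∈ e.target, ∀ u v : Eucl m,
    Coord.covDerivOneForm (bilinInChart g.inner e) (oneFormInChart θ e) y u v = 0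
  /-- `dω = θ ∧ ω`. -/
  lee : ∀ e ∈ IsManifold.maximalAtlas 𝓘(ℝ, Eucl m) ∞ M, ∀ y ∈ e.target, ∀ u v w : Eucl m,
    Coord.extDerivTwoForm (bilinInChart (fundamentalForm g.inner J) e) y u v w =
      Coord.wedgeOneTwo (oneFormInChart θ e) (bilinInChart (fundamentalForm g.inner J) e) y u v w

/-- The tensor equation `Ric = lam g + α θᶜ ⊗ θᶜ + β θ ⊗ θ`, in every smooth chart. -/
def RicciDecomposition
    (g : ContMDiffRiemannianMetric 𝓘(ℝ, Eucl m) ∞ (Eucl m)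
      (TangentSpace 𝓘(ℝ, Eucl m) : M → Type))
    (J : ∀ x : M, TangentSpace 𝓘(ℝ, Eucl m) x →L[ℝ] TangentSpace 𝓘(ℝ, Eucl m) x)
    (θ : ∀ x : M, TangentSpace 𝓘(ℝ, Eucl m) x →L[ℝ] ℝ) (lam α β : M → ℝ) : Prop :=
  ∀ e ∈ IsManifold.maximalAtlas 𝓘(ℝ, Eucl m) ∞ M, ∀ y ∈ e.target, ∀ u v : Eucl m,
    Coord.ricci (bilinInChart g.inner e) y u v =
      lam (e.symm y) * bilinInChart g.inner e y u v
      + α (e.symm y) *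
        (oneFormInChart (antiLeeForm J θ) e y u * oneFormInChart (antiLeeForm J θ) e y v)
      + β (e.symm y) * (oneFormInChart θ e y u * oneFormInChart θ e y v)

end Manifold

end

/-! Write m = 2n+2, let U be the g-dual of θ and V = -JU the g-dual of θᶜ; both are unit vectors and
they are orthogonal. Every identity is tensorial, so the argument runs in a chart, on an open subset
of a vector space, with the Levi-Civita connection given by its Christoffel form.

The first two equations come from evaluating Ric on U and on V. Since θ is parallel, curvature takes
values in ker θ, so Ric(U,U) = 0 (`ric_dual_dual`), that is λ + β = 0. Integrability of J and dω =
θ∧ω determine ∇J in terms of θ (`two_smul_covDeriv_complexStructure`), hence also ∇θᶜ, which turns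
out to be skew. The Ricci identity for θᶜ then shows that planes spanned by V and a vector
orthogonal to U and V have sectional curvature 1/4 (`antiLee_curv`), so Ric(V,V) = (m-2)/4 = n/2,
that is λ + α = n/2.

For constancy, Ric = λ(g - θᶜ⊗θᶜ - θ⊗θ) + (n/2) θᶜ⊗θᶜ is put into the contracted Bianchi identity d
scal = 2 div Ric. Because θᶜ has constant length and skew covariant derivative, its derivatives
contribute nothing, and what remains is (m-2) dλ = 2(dλ - dλ(V)θᶜ - dλ(U)θ). Evaluation on U and V
kills dλ(U) and dλ(V), leaving (m-4) dλ = 0. Connectedness makes λ constant, and then α = n/2 - λ is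
constant. -/

noncomputable section

set_option maxSynthPendingDepth 3

/-! ### Pointwise linear algebra: orthonormal bases, traces, and ∇J from the Lee form. -/

section LinearAlgebra

variable {E : Type*} [NormedAddCommGroup E] [NormedSpace ℝ E]

/-- Orthogonalise, then rescale by square roots. The form is the metric at one point and need not be
related to the norm of `E`, so orthonormality is stated for `B` itself. -/
theorem exists_orthonormal_basis_of_posDef [FiniteDimensional ℝ E] (B : E →L[ℝ] E →L[ℝ] ℝ)
    (hsymm : ∀ u v, B u v = B v u) (hpos : ∀ u, u ≠ 0 → 0 < B u u) :
    ∃ b : Module.Basis (Fin (Module.finrank ℝ E)) ℝ E,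
      ∀ i j, B (b i) (b j) = if i = j then 1 else 0 := by
  let B' : LinearMap.BilinForm ℝ E :=
    LinearMap.mk₂ ℝ (fun u v => B u v) (by simp) (by simp) (by simp) (by simp)
  have hB' : LinearMap.IsSymm B' := ⟨fun u v => hsymm u v⟩
  obtain ⟨v, hv⟩ := LinearMap.BilinForm.exists_orthogonal_basis hB'
  have hv' : ∀ i j, i ≠ j → B (v i) (v j) = 0 := fun i j hij => hv hij
  have hp : ∀ i, 0 < B (v i) (v i) := fun i => hpos _ (v.ne_zero i)
  have hs : ∀ i, Real.sqrt (B (v i) (v i)) ≠ 0 := fun i => (Real.sqrt_pos.2 (hp i)).ne'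
  refine ⟨v.isUnitSMul (w := fun i => (Real.sqrt (B (v i) (v i)))⁻¹)
    (fun i => (isUnit_iff_ne_zero.2 (inv_ne_zero (hs i)))), fun i j => ?_⟩
  simp only [Module.Basis.isUnitSMul_apply, map_smul, smul_apply, smul_eq_mul]
  by_cases h : i = j
  · subst h
    have := Real.mul_self_sqrt (hp i).le
    simp only [if_true]
    field_simp [hs i]
    rw [sq]; exact this.symm
  · simp [h, hv' i j h]

variable {B : E →L[ℝ] E →L[ℝ] ℝ} {ι : Type*} [Fintype ι] [DecidableEq ι]
  {b : Module.Basis ι ℝ E}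

theorem repr_of_orthonormal (hb : ∀ i j, B (b i) (b j) = if i = j then 1 else 0) (x : E)
    (i : ι) : b.repr x i = B x (b i) := by
  conv_rhs => rw [← b.sum_repr x]
  simp only [map_sum, map_smul, sum_apply, smul_apply, hb]
  simp

theorem sum_apply_smul_of_orthonormal (hb : ∀ i j, B (b i) (b j) = if i = j then 1 else 0)
    (x : E) : ∑ i, B x (b i) • b i = x := by
  conv_rhs => rw [← b.sum_repr x]
  simp only [repr_of_orthonormal hb]

theorem sum_mul_of_orthonormal (hb : ∀ i j, B (b i) (b j) = if i = j then 1 else 0)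
    (x : E) (φ : E →L[ℝ] ℝ) : ∑ i, B x (b i) * φ (b i) = φ x := by
  conv_rhs => rw [← sum_apply_smul_of_orthonormal hb x]
  simp

theorem trace_eq_sum_orthonormal (hb : ∀ i j, B (b i) (b j) = if i = j then 1 else 0)
    (f : E →ₗ[ℝ] E) : LinearMap.trace ℝ E f = ∑ i, B (f (b i)) (b i) := by
  rw [LinearMap.trace_eq_matrix_trace ℝ b]
  simp [Matrix.trace, LinearMap.toMatrix_apply, repr_of_orthonormal hb]

/-- The covariant derivative `A` of the complex structure of a locally conformally Kähler metric is
determined by the Lee form. -/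
theorem two_smul_covDeriv_complexStructure
    {G : E →L[ℝ] E →L[ℝ] ℝ} {J : E →L[ℝ] E} {A : E → E → E} {θ : E →L[ℝ] ℝ} {U : E}
    (hsymm : ∀ u v, G u v = G v u) (hpos : ∀ u, u ≠ 0 → 0 < G u u)
    (hJ : ∀ u, J (J u) = -u) (hG : ∀ u v, G (J u) (J v) = G u v)
    (hU : ∀ v, θ v = G U v)
    (hAJ : ∀ x y, A x (J y) = -J (A x y))
    (hAG : ∀ x y z, G (A x y) z = -G y (A x z))
    (hN : ∀ u v, A (J u) v - A (J v) u + J (A v u) - J (A u v) = 0)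
    (hd : ∀ x y z, G y (A x z) + G z (A y x) + G x (A z y) =
      θ x * G y (J z) + θ y * G z (J x) + θ z * G x (J y)) (x y : E) :
    (2 : ℝ) • A x y = θ (J y) • x + G x y • J U - θ y • J x - G x (J y) • U := by
  have hJG : ∀ u v, G (J u) v = -G u (J v) := fun u v => by
    rw [← hG u (J v), hJ]; simp
  refine sub_eq_zero.1 (by_contra fun hne => (hpos _ hne).ne' ?_)
  have key : ∀ z, G ((2 : ℝ) • A x y - (θ (J y) • x + G x y • J U - θ y • J x - G x (J y) • U)) z
      = 0 := by
    intro z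
    -- Subtract dω at (x, Jy, Jz) from dω at (x, y, z). The unwanted covariant derivatives of J
    -- combine into the Nijenhuis tensor of (y, z) paired with Jx, which vanishes; twice G(y, A x z)
    -- survives.
    have h1 := hd x (J y) (J z)
    have h2 := hd x y z
    have h3 := congrArg (fun w => G w (J x)) (hN y z)
    simp only [map_sub, map_add, map_zero, add_apply,
      sub_apply, zero_apply, hG] at h3
    have e1 : G (J y) (A x (J z)) = -G y (A x z) := by rw [hAJ]; simp [hG]
    have e2 : G (J z) (A (J y) x) = -G (A (J y) z) (J x) := by
      have := hAG (J y) (J z) x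
      rw [hAJ] at this
      simp only [map_neg, neg_apply, hJG] at this
      rw [hJG]
      linarith
    have e3 : G x (A (J z) (J y)) = G (A (J z) y) (J x) := by
      rw [hAJ, map_neg, hsymm (A (J z) y), hJG]
    have e4 := hAG x y z
    rw [e1, e2, e3] at h1
    rw [hsymm x (A z y), hsymm z (A y x)] at h2
    have e5 := hAG y z x
    rw [hsymm z (A y x)] at e5
    simp only [hJ, hG, map_neg] at h1
    rw [hJG y z] at h1
    simp only [map_sub, map_add, map_smul, add_apply,
      sub_apply, smul_apply, smul_eq_mul]
    rw [hJG U z, ← hU, ← hU, hsymm x z, hJG x z]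
    have e7 : G z (J x) = - G x (J z) := by rw [hsymm, hJG]
    rw [e7] at h2
    linarith
  exact key _

end LinearAlgebra

/-! ### The Levi-Civita connection of a metric on an open set. -/

namespace Coord

variable {E : Type*} [NormedAddCommGroup E] [NormedSpace ℝ E]

/-- The Christoffel map as a field of continuous bilinear maps. -/
def christoffelCLM (G : E → E →L[ℝ] E →L[ℝ] ℝ) (y : E) :
    E →L[ℝ] E →L[ℝ] E :=
  (ContinuousLinearMap.compL ℝ E (E →L[ℝ] ℝ) E (G y).inverse).comp
    ((1 / 2 : ℝ) • (fderiv ℝ G y + (fderiv ℝ G y).flip -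
      ((ContinuousLinearMap.flipₗᵢ ℝ E E ℝ).toContinuousLinearEquiv :
        (E →L[ℝ] E →L[ℝ] ℝ) →L[ℝ] E →L[ℝ] E →L[ℝ] ℝ).comp (fderiv ℝ G y).flip))

/-- `G` is a smooth Riemannian metric on `s`. -/
structure IsMetricOn (G : E → E →L[ℝ] E →L[ℝ] ℝ) (s : Set E) : Prop where
  isOpen : IsOpen s
  contDiffOn : ContDiffOn ℝ ∞ G s
  symm : ∀ y ∈ s, ∀ u v, G y u v = G y v u
  pos : ∀ y ∈ s, ∀ u, u ≠ 0 → 0 < G y u u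

namespace IsMetricOn

variable {G : E → E →L[ℝ] E →L[ℝ] ℝ} {s : Set E} {y : E}

theorem contDiffAt (hG : IsMetricOn G s) (hy : y ∈ s) : ContDiffAt ℝ ∞ G y :=
  hG.contDiffOn.contDiffAt (hG.isOpen.mem_nhds hy)

theorem differentiableAt (hG : IsMetricOn G s) (hy : y ∈ s) : DifferentiableAt ℝ G y :=
  (hG.contDiffAt hy).differentiableAt (by simp)

theorem fderiv_symm (hG : IsMetricOn G s) (hy : y ∈ s) (x u v : E) :
    fderiv ℝ G y x u v = fderiv ℝ G y x v u := by
  have h : ∀ u v, HasFDerivAt (fun z => G z u v)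
      (((ContinuousLinearMap.apply ℝ ℝ v).comp (ContinuousLinearMap.apply ℝ _ u)).comp
        (fderiv ℝ G y)) y := fun u v =>
    ((ContinuousLinearMap.apply ℝ ℝ v).comp (ContinuousLinearMap.apply ℝ _ u)).hasFDerivAt.comp y
      (hG.differentiableAt hy).hasFDerivAt
  have h' := (h v u).congr_of_eventuallyEq (f₁ := fun z => G z u v) (by
    filter_upwards [hG.isOpen.mem_nhds hy] with z hz using hG.symm z hz u v)
  simpa using congrArg (fun L => L x) ((h u v).unique h')

variable [FiniteDimensional ℝ E]

/-- Positivity gives injectivity and dimensions agree. This makes the inverse metric in the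
Christoffel form a genuine, smoothly varying inverse. -/
theorem isInvertible (hG : IsMetricOn G s) (hy : y ∈ s) : (G y).IsInvertible := by
  have hinj : Function.Injective (G y : E →ₗ[ℝ] (E →L[ℝ] ℝ)) := by
    refine (injective_iff_map_eq_zero _).2 fun u hu => by_contra fun hne => ?_
    have := hG.pos y hy u hne
    have h0 : G y u = 0 := hu
    simp [h0] at this
  have hdim : Module.finrank ℝ E = Module.finrank ℝ (E →L[ℝ] ℝ) := by
    rw [← (LinearMap.toContinuousLinearMap (𝕜 := ℝ) (E := E) (F' := ℝ)).finrank_eq]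
    exact (Subspace.dual_finrank_eq (K := ℝ) (V := E)).symm
  exact ⟨(LinearEquiv.ofInjectiveOfFinrankEq (G y : E →ₗ[ℝ] (E →L[ℝ] ℝ)) hinj
    hdim).toContinuousLinearEquiv, by ext; rfl⟩

theorem apply_christoffel (hG : IsMetricOn G s) (hy : y ∈ s) (u v w : E) :
    G y (christoffelCLM G y u v) w =
      1 / 2 * (fderiv ℝ G y u v w + fderiv ℝ G y v u w - fderiv ℝ G y w u v) := by
  obtain ⟨e, he⟩ := hG.isInvertible hy
  simp only [christoffelCLM, ContinuousLinearMap.comp_apply, ContinuousLinearMap.compL_apply]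
  rw [← he, ContinuousLinearMap.inverse_equiv]
  simp

set_option synthInstance.maxHeartbeats 200000 in
theorem contDiffOn_christoffel (hG : IsMetricOn G s) : ContDiffOn ℝ ∞ (christoffelCLM G) s := by
  intro y hy
  refine ContDiffAt.contDiffWithinAt ?_
  have h1 : ContDiffAt ℝ ∞ (fun z => (G z).inverse) y :=
    (hG.isInvertible hy).contDiffAt_map_inverse.comp y (hG.contDiffAt hy)
  have h2 : ContDiffAt ℝ ∞ (fun z => fderiv ℝ G z) y :=
    (hG.contDiffAt hy).fderiv_right (m := ∞) (by simp)
  have hf : ContDiffAt ℝ ∞ (fun z => (fderiv ℝ G z).flip) y :=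
    (ContinuousLinearMap.flipₗᵢ ℝ E E (E →L[ℝ] ℝ)).contDiff.contDiffAt.comp y h2
  unfold christoffelCLM
  refine ContDiffAt.clm_comp ?_ ?_
  · exact (ContinuousLinearMap.compL ℝ E (E →L[ℝ] ℝ) E).contDiff.contDiffAt.comp
      y h1
  · exact ((h2.add hf).sub (contDiffAt_const.clm_comp hf)).const_smul _

theorem contDiffAt_christoffel (hG : IsMetricOn G s) (hy : y ∈ s) :
    ContDiffAt ℝ ∞ (christoffelCLM G) y :=
  hG.contDiffOn_christoffel.contDiffAt (hG.isOpen.mem_nhds hy)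

theorem christoffel_symm (hG : IsMetricOn G s) (hy : y ∈ s) (u v : E) :
    christoffelCLM G y u v = christoffelCLM G y v u := by
  refine sub_eq_zero.1 (by_contra fun hne => (hG.pos y hy _ hne).ne' ?_)
  rw [map_sub (G y), sub_apply, hG.apply_christoffel hy, hG.apply_christoffel hy,
    hG.fderiv_symm hy _ u v]
  ring

/-- Metric compatibility ∇G = 0, from the Koszul formula. Later computations use it to trade each
derivative of `G` for Christoffel terms. -/
theorem fderiv_eq (hG : IsMetricOn G s) (hy : y ∈ s) (u v w : E) :
    fderiv ℝ G y u v w =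
      G y (christoffelCLM G y u v) w + G y v (christoffelCLM G y u w) := by
  rw [hG.symm y hy v, hG.apply_christoffel hy, hG.apply_christoffel hy,
    hG.fderiv_symm hy u w v]
  ring

end IsMetricOn

/-! ### Curvature of a connection form and the second Bianchi identity. -/

/-- The curvature of the connection with connection form `A`. -/
def curv (A : E → E →L[ℝ] E →L[ℝ] E) (y u v w : E) : E :=
  fderiv ℝ A y u v w - fderiv ℝ A y v u w + A y u (A y v w) - A y v (A y u w)

/-- The covariant derivative `(∇_x R)(u, v)w` of the curvature. -/
def covDerivCurv (A : E → E →L[ℝ] E →L[ℝ] E) (y x u v w : E) : E :=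
  fderiv ℝ (fun z => curv A z u v w) y x + A y x (curv A y u v w) - curv A y (A y x u) v w
    - curv A y u (A y x v) w - curv A y u v (A y x w)

section Connection

variable {A : E → E →L[ℝ] E →L[ℝ] E} {y : E}

theorem isLinearMap_curv (A : E → E →L[ℝ] E →L[ℝ] E) (y v w : E) :
    IsLinearMap ℝ (fun u => curv A y u v w) :=
  ⟨fun a b => by simp only [curv, map_add, add_apply]; abel,
   fun c a => by simp only [curv, map_smul, smul_apply]; module⟩

theorem curv_antisymm (A : E → E →L[ℝ] E →L[ℝ] E) (y u v w : E) :
    curv A y u v w = -curv A y v u w := by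
  simp only [curv]; abel

theorem hasFDerivAt_apply_apply (hA : DifferentiableAt ℝ A y) (u w : E) :
    HasFDerivAt (fun z => A z u w)
      (((ContinuousLinearMap.apply ℝ E w).comp (ContinuousLinearMap.apply ℝ _ u)).comp
        (fderiv ℝ A y)) y :=
  ((ContinuousLinearMap.apply ℝ E w).comp (ContinuousLinearMap.apply ℝ _ u)).hasFDerivAt.comp
    y hA.hasFDerivAt

theorem fderiv_apply_apply (hA : DifferentiableAt ℝ A y) (x u w : E) :
    fderiv ℝ (fun z => A z u w) y x = fderiv ℝ A y x u w := by
  rw [(hasFDerivAt_apply_apply hA u w).fderiv]; rfl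

theorem hasFDerivAt_curv (hA : ContDiffAt ℝ ∞ A y) (u v w : E) :
    ∃ L : E →L[ℝ] E, HasFDerivAt (fun z => curv A z u v w) L y ∧
      ∀ x, L x = fderiv ℝ (fderiv ℝ A) y x u v w - fderiv ℝ (fderiv ℝ A) y x v u w
        + (fderiv ℝ A y x u (A y v w) + A y u (fderiv ℝ A y x v w))
        - (fderiv ℝ A y x v (A y u w) + A y v (fderiv ℝ A y x u w)) := by
  have hA1 : DifferentiableAt ℝ A y := hA.differentiableAt (by simp)
  have hA2 : DifferentiableAt ℝ (fderiv ℝ A) y :=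
    (hA.fderiv_right (m := ∞) (by simp)).differentiableAt (by simp)
  have hc : ∀ c : E, HasFDerivAt (fun _ : E => c) (0 : E →L[ℝ] E) y :=
    fun c => hasFDerivAt_const c y
  have hD : ∀ a b, HasFDerivAt (fun z => fderiv ℝ A z a b w) _ y := fun a b =>
    ((hA2.hasFDerivAt.clm_apply (hc a)).clm_apply (hc b)).clm_apply (hc w)
  have hAA : ∀ a b, HasFDerivAt (fun z => A z a (A z b w)) _ y := fun a b =>
    (hA1.hasFDerivAt.clm_apply (hc a)).clm_apply
      ((hA1.hasFDerivAt.clm_apply (hc b)).clm_apply (hc w))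
  refine ⟨_, (((hD u v).sub (hD v u)).add (hAA u v)).sub (hAA v u), fun x => ?_⟩
  simp
  abel

theorem fderiv_curv (hA : ContDiffAt ℝ ∞ A y) (x u v w : E) :
    fderiv ℝ (fun z => curv A z u v w) y x =
      fderiv ℝ (fderiv ℝ A) y x u v w - fderiv ℝ (fderiv ℝ A) y x v u w
        + (fderiv ℝ A y x u (A y v w) + A y u (fderiv ℝ A y x v w))
        - (fderiv ℝ A y x v (A y u w) + A y v (fderiv ℝ A y x u w)) := by
  obtain ⟨L, hL, h⟩ := hasFDerivAt_curv hA u v w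
  rw [hL.fderiv, h]

theorem differentiableAt_curv (hA : ContDiffAt ℝ ∞ A y) (u v w : E) :
    DifferentiableAt ℝ (fun z => curv A z u v w) y :=
  (hasFDerivAt_curv hA u v w).choose_spec.1.differentiableAt

theorem isLinearMap_covDerivCurv (hA : ContDiffAt ℝ ∞ A y) (x v w : E) :
    IsLinearMap ℝ (fun u => covDerivCurv A y x u v w) :=
  ⟨fun a b => by
    simp only [covDerivCurv, fderiv_curv hA]
    simp only [curv, map_add, map_sub, add_apply]; abel,
   fun c a => by
    simp only [covDerivCurv, fderiv_curv hA]
    simp only [curv, map_smul, map_add, map_sub, smul_apply]; module⟩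

theorem covDerivCurv_antisymm (hA : ContDiffAt ℝ ∞ A y) (x u v w : E) :
    covDerivCurv A y x u v w = -covDerivCurv A y x v u w := by
  simp only [covDerivCurv, fderiv_curv hA]
  rw [curv_antisymm A y u v w, curv_antisymm A y (A y x u), curv_antisymm A y u (A y x v),
    curv_antisymm A y u v (A y x w), map_neg]
  abel

/-- The second Bianchi identity. -/
theorem second_bianchi (hA : ContDiffAt ℝ ∞ A y) (hs : ∀ u v, A y u v = A y v u)
    (x u v w : E) :
    covDerivCurv A y x u v w + covDerivCurv A y u v x w + covDerivCurv A y v x u w = 0 := by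
  have hsym : ∀ a b, fderiv ℝ (fderiv ℝ A) y a b = fderiv ℝ (fderiv ℝ A) y b a := fun a b =>
    (hA.isSymmSndFDerivAt (by simpa using WithTop.coe_le_coe.2 (le_top : (2 : ℕ∞) ≤ ⊤))) a b
  simp only [covDerivCurv, fderiv_curv hA]
  -- Symmetry of second derivatives and vanishing torsion bring all terms to one ordering of the
  -- arguments; they then cancel cyclically.
  rw [hsym u x, hsym v x, hsym v u, hs u x, hs v x, hs v u,
    curv_antisymm A y v (A y x u), curv_antisymm A y (A y x v) u,
    curv_antisymm A y (A y u v) x]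
  simp only [curv, map_add, map_sub]
  abel

/-- The Ricci tensor of the connection with connection form `A`. -/
def ric (A : E → E →L[ℝ] E →L[ℝ] E) (y v w : E) : ℝ :=
  LinearMap.trace ℝ E (isLinearMap_curv A y v w).mk'

/-- The covariant derivative `(∇_x Ric)(v, w)` of the Ricci tensor. -/
def covDerivRic (A : E → E →L[ℝ] E →L[ℝ] E) (y x v w : E) : ℝ :=
  fderiv ℝ (fun z => ric A z v w) y x - ric A y (A y x v) w - ric A y v (A y x w)

theorem trace_eq_sum_coord [FiniteDimensional ℝ E] {f : E → E} (hf : IsLinearMap ℝ f) :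
    LinearMap.trace ℝ E hf.mk' =
      ∑ i, LinearMap.toContinuousLinearMap ((Module.finBasis ℝ E).coord i)
        (f (Module.finBasis ℝ E i)) := by
  rw [LinearMap.trace_eq_matrix_trace ℝ (Module.finBasis ℝ E)]
  simp [Matrix.trace, LinearMap.toMatrix_apply]

/-- Contraction commutes with covariant differentiation: the two corrections in the contracted slot
are the traces of A_x ∘ R and R ∘ A_x, which are equal. -/
theorem covDerivRic_eq_trace [FiniteDimensional ℝ E] (hA : ContDiffAt ℝ ∞ A y) (x v w : E) :
    covDerivRic A y x v w = LinearMap.trace ℝ E (isLinearMap_covDerivCurv hA x v w).mk' := by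
  have h1 : HasFDerivAt (fun z => ric A z v w)
      (∑ i, (LinearMap.toContinuousLinearMap ((Module.finBasis ℝ E).coord i)).comp
        (fderiv ℝ (fun z => curv A z (Module.finBasis ℝ E i) v w) y)) y := by
    simp only [ric, trace_eq_sum_coord]
    exact HasFDerivAt.fun_sum fun i _ =>
      (LinearMap.toContinuousLinearMap ((Module.finBasis ℝ E).coord i)).hasFDerivAt.comp y
        (differentiableAt_curv hA _ v w).hasFDerivAt
  have h2 := LinearMap.trace_mul_comm ℝ (A y x : E →ₗ[ℝ] E) (isLinearMap_curv A y v w).mk'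
  have h3 : LinearMap.trace ℝ E ((A y x : E →ₗ[ℝ] E) * (isLinearMap_curv A y v w).mk') = _ :=
    trace_eq_sum_coord (f := fun u => A y x (curv A y u v w))
      ((A y x : E →ₗ[ℝ] E) * (isLinearMap_curv A y v w).mk').isLinear
  have h4 : LinearMap.trace ℝ E ((isLinearMap_curv A y v w).mk' * (A y x : E →ₗ[ℝ] E)) = _ :=
    trace_eq_sum_coord (f := fun u => curv A y (A y x u) v w)
      ((isLinearMap_curv A y v w).mk' * (A y x : E →ₗ[ℝ] E)).isLinear
  rw [h3, h4] at h2
  rw [covDerivRic, h1.fderiv, trace_eq_sum_coord, ric, ric, trace_eq_sum_coord, trace_eq_sum_coord]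
  simp only [covDerivCurv, map_add, map_sub, Finset.sum_add_distrib, Finset.sum_sub_distrib,
    sum_apply, ContinuousLinearMap.comp_apply]
  rw [h2]
  ring

end Connection

/-! ### Metric symmetries of the curvature and the contracted Bianchi identity. -/

namespace IsMetricOn

variable [FiniteDimensional ℝ E] {G : E → E →L[ℝ] E →L[ℝ] ℝ} {s : Set E} {y : E}

theorem snd_fderiv_eq (hG : IsMetricOn G s) (hy : y ∈ s) (x u v w : E) :
    fderiv ℝ (fderiv ℝ G) y x u v w =
      fderiv ℝ G y x (christoffelCLM G y u v) w + G y (fderiv ℝ (christoffelCLM G) y x u v) w +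
      (fderiv ℝ G y x v (christoffelCLM G y u w) +
        G y v (fderiv ℝ (christoffelCLM G) y x u w)) := by
  have hG2 : DifferentiableAt ℝ (fderiv ℝ G) y :=
    ((hG.contDiffAt hy).fderiv_right (m := ∞) (by simp)).differentiableAt (by simp)
  have hA := ((hG.contDiffAt_christoffel hy).differentiableAt (by simp)).hasFDerivAt
  have hG1 := (hG.differentiableAt hy).hasFDerivAt
  have hc : ∀ c : E, HasFDerivAt (fun _ : E => c) (0 : E →L[ℝ] E) y :=
    fun c => hasFDerivAt_const c y
  have h1 := ((hG2.hasFDerivAt.clm_apply (hc u)).clm_apply (hc v)).clm_apply (hc w)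
  have h2 := ((hG1.clm_apply ((hA.clm_apply (hc u)).clm_apply (hc v))).clm_apply (hc w)).add
    ((hG1.clm_apply (hc v)).clm_apply ((hA.clm_apply (hc u)).clm_apply (hc w)))
  have h3 := h1.unique (h2.congr_of_eventuallyEq (by
    filter_upwards [hG.isOpen.mem_nhds hy] with z hz using hG.fderiv_eq hz u v w))
  have h4 := congrArg (fun L => L x) h3
  simp at h4
  linarith

/-- Antisymmetrise the derivative of ∇G = 0 in its two derivative directions: the second derivatives
of `G` drop out and the curvature terms remain. -/
theorem curv_skew (hG : IsMetricOn G s) (hy : y ∈ s) (u v w t : E) :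
    G y (curv (christoffelCLM G) y u v w) t = -G y w (curv (christoffelCLM G) y u v t) := by
  have hsym : ∀ a b, fderiv ℝ (fderiv ℝ G) y a b = fderiv ℝ (fderiv ℝ G) y b a := fun a b =>
    ((hG.contDiffAt hy).isSymmSndFDerivAt
      (by simpa using WithTop.coe_le_coe.2 (le_top : (2 : ℕ∞) ≤ ⊤))) a b
  have h1 := hG.snd_fderiv_eq hy u v w t
  have h2 := hG.snd_fderiv_eq hy v u w t
  rw [hsym] at h2
  simp only [hG.fderiv_eq hy] at h1 h2
  simp only [curv, map_add, map_sub, add_apply, sub_apply]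
  linarith

theorem covDerivCurv_skew (hG : IsMetricOn G s) (hy : y ∈ s) (x u v w t : E) :
    G y (covDerivCurv (christoffelCLM G) y x u v w) t =
      -G y w (covDerivCurv (christoffelCLM G) y x u v t) := by
  have hA := hG.contDiffAt_christoffel hy
  have hG1 := (hG.differentiableAt hy).hasFDerivAt
  have hc : ∀ c : E, HasFDerivAt (fun _ : E => c) (0 : E →L[ℝ] E) y :=
    fun c => hasFDerivAt_const c y
  have hR : ∀ w, HasFDerivAt (fun z => curv (christoffelCLM G) z u v w) _ y := fun w =>
    (differentiableAt_curv hA u v w).hasFDerivAt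
  have h1 := ((hG1.clm_apply (hR w)).clm_apply (hc t)).add
    ((hG1.clm_apply (hc w)).clm_apply (hR t))
  have h2 := h1.unique ((hasFDerivAt_const (0 : ℝ) y).congr_of_eventuallyEq (by
    filter_upwards [hG.isOpen.mem_nhds hy] with z hz
    simp [hG.curv_skew hz u v w t]))
  have h3 := congrArg (fun L => L x) h2
  simp [hG.fderiv_eq hy] at h3
  have e1 := hG.curv_skew hy (christoffelCLM G y x u) v w t
  have e2 := hG.curv_skew hy u (christoffelCLM G y x v) w t
  have e3 := hG.curv_skew hy u v (christoffelCLM G y x w) t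
  have e4 := hG.curv_skew hy u v w (christoffelCLM G y x t)
  simp only [covDerivCurv, map_add, map_sub, add_apply, sub_apply]
  linarith

/-- The contracted second Bianchi identity `d scal = 2 div Ric`. -/
theorem contracted_bianchi (hG : IsMetricOn G s) (hy : y ∈ s) {ι : Type*} [Fintype ι]
    [DecidableEq ι] {b : Module.Basis ι ℝ E}
    (hb : ∀ i j, G y (b i) (b j) = if i = j then 1 else 0) (z : E) :
    ∑ j, covDerivRic (christoffelCLM G) y z (b j) (b j) =
      2 * ∑ j, covDerivRic (christoffelCLM G) y (b j) z (b j) := by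
  have hA := hG.contDiffAt_christoffel hy
  have hric : ∀ x v w, covDerivRic (christoffelCLM G) y x v w =
      ∑ i, G y (covDerivCurv (christoffelCLM G) y x (b i) v w) (b i) := fun x v w => by
    rw [covDerivRic_eq_trace hA, trace_eq_sum_orthonormal hb]
    rfl
  -- The cyclic identity on (z, b i, b j), with skewness applied to one term and antisymmetry to the
  -- other. After summation both right-hand terms are the same divergence with i and j exchanged,
  -- hence the factor 2.
  have h1 : ∀ i j, G y (covDerivCurv (christoffelCLM G) y z (b i) (b j) (b j)) (b i) =
      G y (covDerivCurv (christoffelCLM G) y (b i) (b j) z (b i)) (b j)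
        + G y (covDerivCurv (christoffelCLM G) y (b j) (b i) z (b j)) (b i) := fun i j => by
    have h := congrArg (fun x => G y x (b i))
      (second_bianchi hA (hG.christoffel_symm hy) z (b i) (b j) (b j))
    rw [covDerivCurv_antisymm hA (b j)] at h
    simp only [map_add, map_neg, add_apply, neg_apply, map_zero, zero_apply] at h
    have h2 := hG.covDerivCurv_skew hy (b i) (b j) z (b j) (b i)
    rw [hG.symm y hy (b j)] at h2
    linarith
  simp only [hric, h1, Finset.sum_add_distrib]
  rw [Finset.sum_comm (f := fun j i =>
    G y (covDerivCurv (christoffelCLM G) y (b i) (b j) z (b i)) (b j)), two_mul]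

end IsMetricOn

end Coord

/-! ### Vaisman structures on an open set: ∇J, ∇θᶜ and curvature. -/

namespace Coord

variable {E : Type*} [NormedAddCommGroup E] [NormedSpace ℝ E]

/-- `G`, `J`, `θ` are the metric, the complex structure and the Lee form of a normalized Vaisman
structure on the open set `s`; the conditions are written with constant vector fields. -/
structure IsVaismanOn (G : E → E →L[ℝ] E →L[ℝ] ℝ) (J : E → E →L[ℝ] E) (θ : E → E →L[ℝ] ℝ)
    (s : Set E) : Prop extends IsMetricOn G s where
  contDiffOn_J : ContDiffOn ℝ ∞ J s
  contDiffOn_θ : ContDiffOn ℝ ∞ θ s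
  J_sq : ∀ y ∈ s, ∀ u, J y (J y u) = -u
  hermitian : ∀ y ∈ s, ∀ u v, G y (J y u) (J y v) = G y u v
  exists_dual : ∀ y ∈ s, ∃ U, (∀ v, θ y v = G y U v) ∧ G y U U = 1
  integrable : ∀ y ∈ s, ∀ u v, fderiv ℝ J y (J y u) v - fderiv ℝ J y (J y v) u
    + J y (fderiv ℝ J y v u) - J y (fderiv ℝ J y u v) = 0
  parallel : ∀ y ∈ s, ∀ u v, fderiv ℝ θ y u v = θ y (christoffelCLM G y u v)
  lee : ∀ y ∈ s, ∀ u v w,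
    (fderiv ℝ G y u v (J y w) + G y v (fderiv ℝ J y u w))
      + (fderiv ℝ G y v w (J y u) + G y w (fderiv ℝ J y v u))
      + (fderiv ℝ G y w u (J y v) + G y u (fderiv ℝ J y w v)) =
    θ y u * G y v (J y w) + θ y v * G y w (J y u) + θ y w * G y u (J y v)

/-- The covariant derivative `(∇_x J)v` of an endomorphism field. -/
def covDerivEndo (G : E → E →L[ℝ] E →L[ℝ] ℝ) (J : E → E →L[ℝ] E) (y x v : E) : E :=
  fderiv ℝ J y x v + christoffelCLM G y x (J y v) - J y (christoffelCLM G y x v)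

namespace IsVaismanOn

variable {G : E → E →L[ℝ] E →L[ℝ] ℝ} {J : E → E →L[ℝ] E} {θ : E → E →L[ℝ] ℝ} {s : Set E} {y : E}

theorem hasFDerivAt_J (h : IsVaismanOn G J θ s) (hy : y ∈ s) : HasFDerivAt J (fderiv ℝ J y) y :=
  ((h.contDiffOn_J.contDiffAt (h.isOpen.mem_nhds hy)).differentiableAt (by simp)).hasFDerivAt

theorem contDiffAt_θ (h : IsVaismanOn G J θ s) (hy : y ∈ s) : ContDiffAt ℝ ∞ θ y :=
  h.contDiffOn_θ.contDiffAt (h.isOpen.mem_nhds hy)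

theorem hasFDerivAt_θ (h : IsVaismanOn G J θ s) (hy : y ∈ s) : HasFDerivAt θ (fderiv ℝ θ y) y :=
  ((h.contDiffAt_θ hy).differentiableAt (by simp)).hasFDerivAt

theorem fderiv_J_J (h : IsVaismanOn G J θ s) (hy : y ∈ s) (x v : E) :
    fderiv ℝ J y x (J y v) + J y (fderiv ℝ J y x v) = 0 := by
  have hJ := h.hasFDerivAt_J hy
  have h1 := hJ.clm_apply (hJ.clm_apply (hasFDerivAt_const v y))
  have h2 := h1.unique ((hasFDerivAt_const (-v) y).congr_of_eventuallyEq (by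
    filter_upwards [h.isOpen.mem_nhds hy] with z hz using h.J_sq z hz v))
  have h3 := congrArg (fun L => L x) h2
  simp at h3
  rw [add_comm]; exact h3

theorem covDerivEndo_J (h : IsVaismanOn G J θ s) (hy : y ∈ s) (x v : E) :
    covDerivEndo G J y x (J y v) = -J y (covDerivEndo G J y x v) := by
  have h1 := h.fderiv_J_J hy x v
  simp only [covDerivEndo, map_add, map_sub, h.J_sq y hy, map_neg]
  rw [← eq_neg_iff_add_eq_zero] at h1
  rw [h1]
  abel

theorem J_skew (h : IsVaismanOn G J θ s) (hy : y ∈ s) (u v : E) :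
    G y (J y u) v = -G y u (J y v) := by
  rw [← h.hermitian y hy u (J y v), h.J_sq y hy]; simp

theorem hasFDerivAt_antiLee (h : IsVaismanOn G J θ s) (hy : y ∈ s) (w : E) :
    ∃ L : E →L[ℝ] ℝ, HasFDerivAt (fun z => θ z (J z w)) L y ∧
      ∀ x, L x = θ y (J y (christoffelCLM G y x w)) + θ y (covDerivEndo G J y x w) := by
  refine ⟨_, (h.hasFDerivAt_θ hy).clm_apply
    ((h.hasFDerivAt_J hy).clm_apply (hasFDerivAt_const w y)), fun x => ?_⟩
  simp [h.parallel y hy, covDerivEndo]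

/-- A vector dual to the Lee form together with the vector dual to the anti-Lee form. -/
theorem exists_frame (h : IsVaismanOn G J θ s) (hy : y ∈ s) :
    ∃ U V, (∀ v, G y U v = θ y v) ∧ (∀ v, G y V v = θ y (J y v)) ∧ θ y U = 1 ∧ θ y V = 0 ∧
      θ y (J y U) = 0 ∧ θ y (J y V) = 1 ∧ J y U = -V ∧ J y V = U := by
  obtain ⟨U, hU, hUU⟩ := h.exists_dual y hy
  have h3 : θ y (J y U) = 0 := by
    have := h.J_skew hy U U
    rw [h.symm y hy, ← hU] at this
    linarith
  refine ⟨U, -(J y U), fun v => (hU v).symm, fun v => ?_, by rw [hU, hUU], by simp [h3], h3, ?_,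
    by simp, ?_⟩
  · rw [map_neg, neg_apply, h.J_skew hy, neg_neg, hU]
  · rw [map_neg, h.J_sq y hy, neg_neg, hU, hUU]
  · rw [map_neg, h.J_sq y hy, neg_neg]

variable [FiniteDimensional ℝ E]

/-- Differentiate the Hermitian condition using ∇G = 0, then replace v by -Jv and use that ∇J
anticommutes with J. -/
theorem covDerivEndo_skew (h : IsVaismanOn G J θ s) (hy : y ∈ s) (x u v : E) :
    G y (covDerivEndo G J y x u) v = -G y u (covDerivEndo G J y x v) := by
  have hJ := h.hasFDerivAt_J hy
  have hG := (h.differentiableAt hy).hasFDerivAt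
  have hc : ∀ c : E, HasFDerivAt (fun _ : E => c) (0 : E →L[ℝ] E) y :=
    fun c => hasFDerivAt_const c y
  have key : ∀ u v, G y (covDerivEndo G J y x u) (J y v)
      + G y (J y u) (covDerivEndo G J y x v) = 0 := fun u v => by
    have h1 := (hG.clm_apply (hJ.clm_apply (hc u))).clm_apply (hJ.clm_apply (hc v))
    have h2 := h1.unique (((hG.clm_apply (hc u)).clm_apply (hc v)).congr_of_eventuallyEq (by
      filter_upwards [h.isOpen.mem_nhds hy] with z hz using h.hermitian z hz u v))
    have h3 := congrArg (fun L => L x) h2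
    simp at h3
    simp only [h.fderiv_eq hy] at h3
    have h4 := h.hermitian y hy (christoffelCLM G y x u) v
    have h5 := h.hermitian y hy u (christoffelCLM G y x v)
    simp only [covDerivEndo, map_add, map_sub, add_apply, sub_apply]
    linarith
  have h1 := key u (-(J y v))
  rw [map_neg, h.J_sq y hy, neg_neg] at h1
  have h2 : covDerivEndo G J y x (-(J y v)) = J y (covDerivEndo G J y x v) := by
    have := h.covDerivEndo_J hy x v
    simp only [covDerivEndo, map_neg] at this ⊢
    rw [← neg_eq_iff_eq_neg] at this
    rw [← this]; abel
  rw [h2, h.hermitian y hy] at h1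
  linarith

/-- As the connection is torsion-free and metric, partial derivatives in the Nijenhuis tensor and in
dω may be replaced by covariant ones; the pointwise result then applies. -/
theorem two_smul_covDerivEndo (h : IsVaismanOn G J θ s) (hy : y ∈ s) {U : E}
    (hU : ∀ v, θ y v = G y U v) (x v : E) :
    (2 : ℝ) • covDerivEndo G J y x v =
      θ y (J y v) • x + G y x v • J y U - θ y v • J y x - G y x (J y v) • U := by
  refine two_smul_covDeriv_complexStructure (h.symm y hy) (h.pos y hy) (h.J_sq y hy)
    (h.hermitian y hy) hU (h.covDerivEndo_J hy) (h.covDerivEndo_skew hy) ?_ ?_ x v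
  · intro u v
    have h1 := h.integrable y hy u v
    simp only [covDerivEndo, map_add, map_sub, h.J_sq y hy]
    rw [h.christoffel_symm hy (J y u) (J y v), h.christoffel_symm hy (J y u) v,
      h.christoffel_symm hy (J y v) u, h.christoffel_symm hy u v, ← h1]
    abel
  · intro u v w
    have h1 := h.lee y hy u v w
    simp only [h.fderiv_eq hy] at h1
    simp only [covDerivEndo, map_add, map_sub]
    rw [← h1, h.christoffel_symm hy v u, h.christoffel_symm hy w u, h.christoffel_symm hy w v]
    have e : ∀ a b, G y a (J y b) = - G y b (J y a) := fun a b => by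
      rw [h.symm y hy, h.J_skew hy]
    rw [e v (christoffelCLM G y u w), e w (christoffelCLM G y u v), e u (christoffelCLM G y v w)]
    ring

/-- Since ∇θ = 0, the left side is (∇_v θᶜ)(w). The right side is skew in v and w, so θᶜ is dual to
a Killing field. -/
theorem θ_covDerivEndo (h : IsVaismanOn G J θ s) (hy : y ∈ s) (v w : E) :
    θ y (covDerivEndo G J y v w) =
      1 / 2 * (θ y (J y w) * θ y v - θ y w * θ y (J y v) - G y v (J y w)) := by
  obtain ⟨U, hU, hUU⟩ := h.exists_dual y hy
  have h1 := congrArg (θ y) (h.two_smul_covDerivEndo hy hU v w)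
  have h2 : θ y U = 1 := by rw [hU, hUU]
  have h3 : θ y (J y U) = 0 := by
    have := h.J_skew hy U U
    rw [h.symm y hy, ← hU] at this
    linarith
  simp only [map_add, map_sub, map_smul, smul_eq_mul, h2, h3] at h1
  linarith

/-- The curvature annihilates the parallel Lee form. -/
theorem θ_curv (h : IsVaismanOn G J θ s) (hy : y ∈ s) (u v w : E) :
    θ y (curv (christoffelCLM G) y u v w) = 0 := by
  have hθ := h.hasFDerivAt_θ hy
  have hθ2 : HasFDerivAt (fderiv ℝ θ) (fderiv ℝ (fderiv ℝ θ) y) y :=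
    (((h.contDiffAt_θ hy).fderiv_right (m := ∞) (by simp)).differentiableAt (by simp)).hasFDerivAt
  have hA := ((h.contDiffAt_christoffel hy).differentiableAt (by simp)).hasFDerivAt
  have hc : ∀ c : E, HasFDerivAt (fun _ : E => c) (0 : E →L[ℝ] E) y :=
    fun c => hasFDerivAt_const c y
  have key : ∀ x v, fderiv ℝ (fderiv ℝ θ) y x v w =
      θ y (christoffelCLM G y x (christoffelCLM G y v w))
        + θ y (fderiv ℝ (christoffelCLM G) y x v w) := fun x v => by
    have h1 := (hθ2.clm_apply (hc v)).clm_apply (hc w)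
    have h2 := hθ.clm_apply ((hA.clm_apply (hc v)).clm_apply (hc w))
    have h3 := h1.unique (h2.congr_of_eventuallyEq (by
      filter_upwards [h.isOpen.mem_nhds hy] with z hz using h.parallel z hz v w))
    have h4 := congrArg (fun L => L x) h3
    simp [h.parallel y hy] at h4
    linarith
  have hsym : fderiv ℝ (fderiv ℝ θ) y u v = fderiv ℝ (fderiv ℝ θ) y v u :=
    ((h.contDiffAt_θ hy).isSymmSndFDerivAt
      (by simpa using WithTop.coe_le_coe.2 (le_top : (2 : ℕ∞) ≤ ⊤))) u v
  have h1 := key u v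
  rw [hsym, key] at h1
  simp only [curv, map_add, map_sub]
  linarith

/-- The Ricci identity for the anti-Lee form. -/
theorem antiLee_curv (h : IsVaismanOn G J θ s) (hy : y ∈ s) (u v w : E) :
    2 * θ y (J y (curv (christoffelCLM G) y u v w)) =
      (θ y (covDerivEndo G J y v w) * θ y u - θ y w * θ y (covDerivEndo G J y v u)
        - G y u (covDerivEndo G J y v w))
      - (θ y (covDerivEndo G J y u w) * θ y v - θ y w * θ y (covDerivEndo G J y u v)
        - G y v (covDerivEndo G J y u w)) := by
  have hθ := h.hasFDerivAt_θ hy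
  have hJ := h.hasFDerivAt_J hy
  have hG := (h.differentiableAt hy).hasFDerivAt
  have hA := ((h.contDiffAt_christoffel hy).differentiableAt (by simp)).hasFDerivAt
  have hc : ∀ c : E, HasFDerivAt (fun _ : E => c) (0 : E →L[ℝ] E) y :=
    fun c => hasFDerivAt_const c y
  let η : E → E →L[ℝ] ℝ := fun z => (θ z).comp (J z)
  have hηC : ContDiffOn ℝ ∞ η s := h.contDiffOn_θ.clm_comp h.contDiffOn_J
  have hηa : ContDiffAt ℝ ∞ η y := hηC.contDiffAt (h.isOpen.mem_nhds hy)
  have hη : HasFDerivAt η (fderiv ℝ η y) y := (hηa.differentiableAt (by simp)).hasFDerivAt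
  have hη2 : HasFDerivAt (fderiv ℝ η) (fderiv ℝ (fderiv ℝ η) y) y :=
    ((hηa.fderiv_right (m := ∞) (by simp)).differentiableAt (by simp)).hasFDerivAt
  have hD : ∀ z ∈ s, ∀ v w, fderiv ℝ η z v w =
      η z (christoffelCLM G z v w) + θ z (covDerivEndo G J z v w) := fun z hz v w => by
    have h1 := (h.hasFDerivAt_θ hz).clm_comp (h.hasFDerivAt_J hz)
    rw [h1.fderiv]
    simp [h.parallel z hz, covDerivEndo, η]
  -- Second derivatives of η = θᶜ, found by differentiating the first-order formula for ∇θᶜ.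
  -- Antisymmetrising in x and v produces the curvature.
  have key : ∀ x v, fderiv ℝ (fderiv ℝ η) y x v w =
      fderiv ℝ η y x (christoffelCLM G y v w) + η y (fderiv ℝ (christoffelCLM G) y x v w)
      + 1 / 2 * (fderiv ℝ η y x w * θ y v + η y w * fderiv ℝ θ y x v
        - (fderiv ℝ θ y x w * η y v + θ y w * fderiv ℝ η y x v)
        - (fderiv ℝ G y x v (J y w) + G y v (fderiv ℝ J y x w))) := fun x v => by
    have h1 := (hη2.clm_apply (hc v)).clm_apply (hc w)
    have hηv : ∀ v, HasFDerivAt (fun z => η z v) _ y := fun v => hη.clm_apply (hc v)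
    have hθv : ∀ v, HasFDerivAt (fun z => θ z v) _ y := fun v => hθ.clm_apply (hc v)
    have h2 := (hη.clm_apply ((hA.clm_apply (hc v)).clm_apply (hc w))).add
      (((((hηv w).mul (hθv v)).sub ((hθv w).mul (hηv v))).sub
        ((hG.clm_apply (hc v)).clm_apply (hJ.clm_apply (hc w)))).const_mul (1 / 2 : ℝ))
    have h3 := h1.unique (h2.congr_of_eventuallyEq (by
      filter_upwards [h.isOpen.mem_nhds hy] with z hz
      rw [hD z hz, h.θ_covDerivEndo hz]
      rfl))
    have h4 := congrArg (fun L => L x) h3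
    simp at h4
    linarith
  have hsym : fderiv ℝ (fderiv ℝ η) y u v = fderiv ℝ (fderiv ℝ η) y v u :=
    (hηa.isSymmSndFDerivAt
      (by simpa using WithTop.coe_le_coe.2 (le_top : (2 : ℕ∞) ≤ ⊤))) u v
  have h1 := key u v
  rw [hsym, key] at h1
  simp only [hD y hy, h.fderiv_eq hy, h.parallel y hy] at h1
  have hJD : ∀ a b, fderiv ℝ J y a b = covDerivEndo G J y a b - christoffelCLM G y a (J y b)
      + J y (christoffelCLM G y a b) := fun a b => by simp only [covDerivEndo]; abel
  simp only [hJD, map_add, map_sub] at h1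
  have hηa : ∀ a, θ y (J y a) = η y a := fun a => rfl
  rw [hηa]
  simp only [curv, map_add, map_sub]
  rw [h.θ_covDerivEndo hy u (christoffelCLM G y v w),
    h.θ_covDerivEndo hy v (christoffelCLM G y u w)] at h1
  simp only [hηa] at h1
  rw [h.christoffel_symm hy v u] at h1
  linarith

/-! ### The Ricci tensor of a Vaisman structure. -/

/-- Leibniz rule with `G` and θ parallel: only the derivatives of λ and of θᶜ survive. -/
theorem covDerivRic_eq (h : IsVaismanOn G J θ s) (hy : y ∈ s) {lam : E → ℝ} {c : ℝ}
    (hlam : DifferentiableAt ℝ lam y)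
    (hric : ∀ z ∈ s, ∀ v w, ric (christoffelCLM G) z v w =
      lam z * G z v w + (c - lam z) * (θ z (J z v) * θ z (J z w)) - lam z * (θ z v * θ z w))
    (x v w : E) :
    covDerivRic (christoffelCLM G) y x v w =
      fderiv ℝ lam y x * (G y v w - θ y (J y v) * θ y (J y w) - θ y v * θ y w)
        + (c - lam y) * (θ y (covDerivEndo G J y x v) * θ y (J y w)
          + θ y (J y v) * θ y (covDerivEndo G J y x w)) := by
  have hc : ∀ c : E, HasFDerivAt (fun _ : E => c) (0 : E →L[ℝ] E) y :=
    fun c => hasFDerivAt_const c y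
  have hl := hlam.hasFDerivAt
  have hG := (((h.differentiableAt hy).hasFDerivAt).clm_apply (hc v)).clm_apply (hc w)
  have hθ : ∀ v, HasFDerivAt (fun z => θ z v) _ y := fun v =>
    (h.hasFDerivAt_θ hy).clm_apply (hc v)
  obtain ⟨Lv, hLv, hv⟩ := h.hasFDerivAt_antiLee hy v
  obtain ⟨Lw, hLw, hw⟩ := h.hasFDerivAt_antiLee hy w
  have h1 := (((hl.mul hG).add ((hl.const_sub c).mul (hLv.mul hLw))).sub
    (hl.mul ((hθ v).mul (hθ w)))).congr_of_eventuallyEq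
      (f₁ := fun z => ric (christoffelCLM G) z v w) (by
        filter_upwards [h.isOpen.mem_nhds hy] with z hz using hric z hz v w)
  rw [covDerivRic, h1.fderiv, hric y hy, hric y hy]
  simp [hv, hw, h.fderiv_eq hy, h.parallel y hy]
  ring

theorem ric_dual_dual (h : IsVaismanOn G J θ s) (hy : y ∈ s) {U : E} (hU : ∀ v, G y U v = θ y v) :
    ric (christoffelCLM G) y U U = 0 := by
  obtain ⟨b, hb⟩ := exists_orthonormal_basis_of_posDef (G y) (h.symm y hy) (h.pos y hy)
  rw [ric, trace_eq_sum_orthonormal hb]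
  refine Finset.sum_eq_zero fun i _ => ?_
  change G y (curv (christoffelCLM G) y (b i) U U) (b i) = 0
  rw [h.curv_skew hy, hU, h.θ_curv hy, neg_zero]

/-- Each basis vector b contributes (1 - θᶜ(b)² - θ(b)²)/4, and the squares of each of the unit
covectors θᶜ and θ sum to 1. -/
theorem ric_antiDual_antiDual (h : IsVaismanOn G J θ s) (hy : y ∈ s) {V : E}
    (hV : ∀ v, G y V v = θ y (J y v)) :
    ric (christoffelCLM G) y V V = ((Module.finrank ℝ E : ℝ) - 2) / 4 := by
  obtain ⟨b, hb⟩ := exists_orthonormal_basis_of_posDef (G y) (h.symm y hy) (h.pos y hy)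
  obtain ⟨U, V', hU, hV', hUU, hUV, hJU, hJV, eU, eV⟩ := h.exists_frame hy
  obtain rfl : V = V' := by
    refine sub_eq_zero.1 (by_contra fun hne => (h.pos y hy _ hne).ne' ?_)
    rw [map_sub (G y), sub_apply, hV, hV', sub_self]
  rw [ric, trace_eq_sum_orthonormal hb]
  change ∑ i, G y (curv (christoffelCLM G) y (b i) V V) (b i) = _
  have key : ∀ i, G y (curv (christoffelCLM G) y (b i) V V) (b i) =
      1 / 4 * (1 - θ y (J y (b i)) * θ y (J y (b i)) - θ y (b i) * θ y (b i)) := fun i => by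
    rw [h.curv_skew hy, hV]
    have h1 := h.antiLee_curv hy (b i) V (b i)
    have h2 := congrArg (G y V) (h.two_smul_covDerivEndo hy (fun v => (hU v).symm) (b i) (b i))
    have h3 := h.covDerivEndo_skew hy V (b i) (b i)
    rw [h.symm y hy (covDerivEndo G J y V (b i))] at h3
    have h4 := hb i i
    rw [if_pos rfl] at h4
    have h5 : G y (b i) (J y (b i)) = 0 := by
      have := h.J_skew hy (b i) (b i)
      rw [h.symm y hy] at this
      linarith
    have h7 : G y (b i) U = θ y (b i) := by rw [h.symm y hy, hU]
    simp only [h.θ_covDerivEndo hy, hUV, eV, h5, h7, hV, h.J_sq y hy, map_neg, hUU] at h1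
    simp only [map_add, map_sub, map_smul, smul_eq_mul, h4, h5, h.J_sq y hy, map_neg, hV, hJV,
      eU] at h2
    linarith
  simp only [key, ← Finset.mul_sum, Finset.sum_sub_distrib]
  have s1 := sum_mul_of_orthonormal hb U (θ y)
  have s2 := sum_mul_of_orthonormal hb V ((θ y).comp (J y))
  simp only [hU, hV, ContinuousLinearMap.comp_apply, hUU, hJV] at s1 s2
  rw [s1, s2]
  simp
  ring

variable {lam al be : E → ℝ}

theorem ricci_coeff_of_decomposition (h : IsVaismanOn G J θ s)
    (hric : ∀ z ∈ s, ∀ v w, ric (christoffelCLM G) z v w =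
      lam z * G z v w + al z * (θ z (J z v) * θ z (J z w)) + be z * (θ z v * θ z w))
    (hy : y ∈ s) :
    lam y + al y = ((Module.finrank ℝ E : ℝ) - 2) / 4 ∧ be y = -lam y := by
  obtain ⟨U, V, hU, hV, hUU, hUV, hJU, hJV, eU, eV⟩ := h.exists_frame hy
  have h1 := h.ric_dual_dual hy hU
  have h2 := h.ric_antiDual_antiDual hy hV
  rw [hric y hy] at h1 h2
  simp only [hU, hV, hUU, hUV, hJU, hJV] at h1 h2
  constructor <;> linarith

theorem fderiv_eq_zero_of_decomposition (h : IsVaismanOn G J θ s)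
    (hdim : 4 < Module.finrank ℝ E) (hlam : ContDiffOn ℝ ∞ lam s)
    (hric : ∀ z ∈ s, ∀ v w, ric (christoffelCLM G) z v w =
      lam z * G z v w + al z * (θ z (J z v) * θ z (J z w)) + be z * (θ z v * θ z w))
    (hy : y ∈ s) : fderiv ℝ lam y = 0 := by
  have hl : DifferentiableAt ℝ lam y :=
    (hlam.contDiffAt (h.isOpen.mem_nhds hy)).differentiableAt (by simp)
  have hcov := h.covDerivRic_eq hy hl (c := ((Module.finrank ℝ E : ℝ) - 2) / 4)
    (fun z hz v w => by
      obtain ⟨e1, e2⟩ := h.ricci_coeff_of_decomposition hric hz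
      rw [hric z hz, ← e1, e2]; ring)
  obtain ⟨b, hb⟩ := exists_orthonormal_basis_of_posDef (G y) (h.symm y hy) (h.pos y hy)
  obtain ⟨U, V, hU, hV, hUU, hUV, hJU, hJV, eU, eV⟩ := h.exists_frame hy
  have hB1 : ∀ z, θ y (covDerivEndo G J y V z) = 0 := fun z => by
    rw [h.θ_covDerivEndo hy, hUV, hJV, hV, h.J_sq y hy, map_neg]; ring
  -- (∇_z θᶜ)(V) = 0, reflecting that V has constant length.
  have hB2 : ∀ z, θ y (covDerivEndo G J y z V) = 0 := fun z => by
    rw [h.θ_covDerivEndo hy, hUV, hJV, eV, h.symm y hy, hU]; ring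
  -- Skewness of ∇θᶜ; summed over a basis it says that θᶜ is divergence-free.
  have hB3 : ∀ z, θ y (covDerivEndo G J y z z) = 0 := fun z => by
    have := h.J_skew hy z z
    rw [h.symm y hy] at this
    rw [h.θ_covDerivEndo hy]; linarith
  set dl := fderiv ℝ lam y with hdl
  -- d scal = 2 div Ric at z. The form φ = ∇_z θᶜ enters both sides only through φ(V) = 0.
  have main : ∀ z, dl z * ((Module.finrank ℝ E : ℝ) - 2) =
      2 * (dl z - dl V * θ y (J y z) - dl U * θ y z) := fun z => by
    have h1 := h.contracted_bianchi hy hb z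
    let φ : E →L[ℝ] ℝ := (θ y).comp (fderiv ℝ J y z + (christoffelCLM G y z).comp (J y)
      - (J y).comp (christoffelCLM G y z))
    have hφ : ∀ v, θ y (covDerivEndo G J y z v) = φ v := fun v => rfl
    have hφ' : ∀ v, θ y (covDerivEndo G J y v z) = -φ v := fun v => by
      have := h.J_skew hy v z
      rw [h.symm y hy] at this
      rw [← hφ, h.θ_covDerivEndo hy, h.θ_covDerivEndo hy]; linarith
    have s1 := sum_mul_of_orthonormal hb U (θ y)
    have s2 := sum_mul_of_orthonormal hb V ((θ y).comp (J y))
    have s3 := sum_mul_of_orthonormal hb V φ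
    have s4 := sum_mul_of_orthonormal hb z dl
    have s5 := sum_mul_of_orthonormal hb U dl
    have s6 := sum_mul_of_orthonormal hb V dl
    simp only [hU, hV, ContinuousLinearMap.comp_apply, hUU, hJV] at s1 s2 s3 s5 s6
    rw [← hφ, hB2] at s3
    have hbb : ∀ i, G y (b i) (b i) = 1 := fun i => by simp [hb]
    have t1 : ∑ j, covDerivRic (christoffelCLM G) y z (b j) (b j) =
        dl z * ((Module.finrank ℝ E : ℝ) - 1 - 1) := by
      simp only [hcov, hφ, hbb, Finset.sum_add_distrib, Finset.sum_sub_distrib, ← Finset.mul_sum,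
        mul_comm (φ _), s1, s2, s3]
      simp
    have t2 : ∑ j, covDerivRic (christoffelCLM G) y (b j) z (b j) =
        dl z - dl V * θ y (J y z) - dl U * θ y z := by
      rw [← s4, ← s5, ← s6]
      have e : ∀ j, covDerivRic (christoffelCLM G) y (b j) z (b j) =
          G y z (b j) * dl (b j) - θ y (J y (b j)) * dl (b j) * θ y (J y z)
            - θ y (b j) * dl (b j) * θ y z
            - (((Module.finrank ℝ E : ℝ) - 2) / 4 - lam y) * (θ y (J y (b j)) * φ (b j)) :=
        fun j => by rw [hcov, hφ', hB3]; ring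
      simp only [e, Finset.sum_sub_distrib, ← Finset.sum_mul, ← Finset.mul_sum, s3]
      ring
    rw [t1, t2] at h1
    linarith
  have hd : (4 : ℝ) < Module.finrank ℝ E := by exact_mod_cast hdim
  have hdU : dl U = 0 := by
    have := main U
    rw [hJU, hUU] at this
    have h2 : dl U * ((Module.finrank ℝ E : ℝ) - 2) = 0 := by linarith
    exact (mul_eq_zero.1 h2).resolve_right (by linarith)
  have hdV : dl V = 0 := by
    have := main V
    rw [hJV, hUV] at this
    have h2 : dl V * ((Module.finrank ℝ E : ℝ) - 2) = 0 := by linarith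
    exact (mul_eq_zero.1 h2).resolve_right (by linarith)
  ext z
  have := main z
  rw [hdU, hdV] at this
  -- With dλ(U) = dλ(V) = 0, `main` reads (m-2) dλ = 2 dλ; this is where m ≠ 4 is needed.
  have h2 : dl z * ((Module.finrank ℝ E : ℝ) - 4) = 0 := by linarith
  exact (mul_eq_zero.1 h2).resolve_right (by linarith)

end IsVaismanOn

end Coord

/-! ### Smooth tensor fields have smooth coordinate expressions. -/

section ChartSmoothness

variable {m : ℕ} {M : Type*} [TopologicalSpace M] [ChartedSpace (Eucl m) M]
  [IsManifold 𝓘(ℝ, Eucl m) ∞ M]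

theorem chartAt_mdifferentiable (p : M) :
    (chartAt (Eucl m) p).MDifferentiable 𝓘(ℝ, Eucl m) 𝓘(ℝ, Eucl m) :=
  have : IsManifold 𝓘(ℝ, Eucl m) 1 M := IsManifold.of_le (n := ∞) (by simp)
  mdifferentiable_of_mem_atlas (chart_mem_atlas _ p)

theorem chartCoframe_chartFrame (p : M) {y : Eucl m} (hy : y ∈ (chartAt (Eucl m) p).target)
    (u : Eucl m) :
    chartCoframe (chartAt (Eucl m) p) y (chartFrame (chartAt (Eucl m) p) y u) = u := by
  have h := (chartAt_mdifferentiable p).comp_symm_deriv hy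
  exact congrArg (fun f => f u) h

theorem chartFrame_chartCoframe (p : M) {y : Eucl m} (hy : y ∈ (chartAt (Eucl m) p).target)
    (v : TangentSpace 𝓘(ℝ, Eucl m) ((chartAt (Eucl m) p).symm y)) :
    chartFrame (chartAt (Eucl m) p) y (chartCoframe (chartAt (Eucl m) p) y v) = v := by
  have h := (chartAt_mdifferentiable p).symm_comp_deriv ((chartAt (Eucl m) p).map_target hy)
  rw [(chartAt (Eucl m) p).right_inv hy] at h
  exact congrArg (fun f => f v) h

theorem chartCoframe_eq_continuousLinearMapAt (p : M) {y : Eucl m}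
    (hy : y ∈ (chartAt (Eucl m) p).target) :
    chartCoframe (chartAt (Eucl m) p) y =
      (trivializationAt (Eucl m) (TangentSpace 𝓘(ℝ, Eucl m) : M → Type _) p).continuousLinearMapAt ℝ
        ((chartAt (Eucl m) p).symm y) := by
  have : IsManifold 𝓘(ℝ, Eucl m) 1 M := IsManifold.of_le (n := ∞) (by simp)
  rw [TangentBundle.continuousLinearMapAt_trivializationAt
    ((chartAt (Eucl m) p).map_target hy)]
  rfl

/-- In the tangent trivialization of this chart, the coordinate field of u is the constant u. -/
theorem contMDiffAt_chartFrame (p : M) {y : Eucl m} (hy : y ∈ (chartAt (Eucl m) p).target)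
    (u : Eucl m) :
    ContMDiffAt 𝓘(ℝ, Eucl m) (𝓘(ℝ, Eucl m).prod 𝓘(ℝ, Eucl m)) ∞
      (fun z => TotalSpace.mk' (Eucl m) (E := (TangentSpace 𝓘(ℝ, Eucl m) : M → Type _))
        ((chartAt (Eucl m) p).symm z) (chartFrame (chartAt (Eucl m) p) z u)) y := by
  have hs : ContMDiffAt 𝓘(ℝ, Eucl m) 𝓘(ℝ, Eucl m) ∞ (chartAt (Eucl m) p).symm y :=
    (contMDiffOn_chart_symm (I := 𝓘(ℝ, Eucl m)) (n := ∞) (x := p)).contMDiffAt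
      ((chartAt (Eucl m) p).open_target.mem_nhds hy)
  have hys := (chartAt (Eucl m) p).map_target hy
  rw [(trivializationAt (Eucl m) (TangentSpace 𝓘(ℝ, Eucl m) : M → Type _) p).contMDiffAt_iff
    (by simpa [Trivialization.mem_source] using hys)]
  refine ⟨hs, (contMDiffAt_const (c := u)).congr_of_eventuallyEq ?_⟩
  filter_upwards [(chartAt (Eucl m) p).open_target.mem_nhds hy] with z hz
  have hzs := (chartAt (Eucl m) p).map_target hz
  have h := chartCoframe_chartFrame p hz u
  rw [chartCoframe_eq_continuousLinearMapAt p hz] at h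
  rw [Trivialization.continuousLinearMapAt_apply, Trivialization.coe_linearMapAt_of_mem _
    (by simpa using hzs)] at h
  exact h

theorem contDiffOn_bilinInChart
    {b : ∀ x : M, TangentSpace 𝓘(ℝ, Eucl m) x →L[ℝ] TangentSpace 𝓘(ℝ, Eucl m) x →L[ℝ] ℝ}
    (hb : ContMDiff 𝓘(ℝ, Eucl m) (𝓘(ℝ, Eucl m).prod 𝓘(ℝ, Eucl m →L[ℝ] Eucl m →L[ℝ] ℝ)) ∞
      (fun x => TotalSpace.mk' (Eucl m →L[ℝ] Eucl m →L[ℝ] ℝ)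
        (E := fun x : M => TangentSpace 𝓘(ℝ, Eucl m) x →L[ℝ] TangentSpace 𝓘(ℝ, Eucl m) x →L[ℝ] ℝ)
        x (b x))) (p : M) :
    ContDiffOn ℝ ∞ (bilinInChart b (chartAt (Eucl m) p)) (chartAt (Eucl m) p).target := by
  simp_rw [contDiffOn_clm_apply]
  intro u v y hy
  refine ContDiffAt.contDiffWithinAt ?_
  have hs : ContMDiffAt 𝓘(ℝ, Eucl m) 𝓘(ℝ, Eucl m) ∞ (chartAt (Eucl m) p).symm y :=
    (contMDiffOn_chart_symm (I := 𝓘(ℝ, Eucl m)) (n := ∞) (x := p)).contMDiffAt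
      ((chartAt (Eucl m) p).open_target.mem_nhds hy)
  have hb' : ContMDiffAt 𝓘(ℝ, Eucl m) (𝓘(ℝ, Eucl m).prod 𝓘(ℝ, Eucl m →L[ℝ] Eucl m →L[ℝ] ℝ)) ∞
      (fun z => TotalSpace.mk' (Eucl m →L[ℝ] Eucl m →L[ℝ] ℝ)
        (E := fun x : M => TangentSpace 𝓘(ℝ, Eucl m) x →L[ℝ] TangentSpace 𝓘(ℝ, Eucl m) x →L[ℝ] ℝ)
        ((chartAt (Eucl m) p).symm z) (b ((chartAt (Eucl m) p).symm z))) y :=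
    hb.contMDiffAt.comp y hs
  have h := ContMDiffAt.clm_bundle_apply₂ (E₃ := fun _ : M => ℝ) (F₃ := ℝ) hb'
    (contMDiffAt_chartFrame p hy u) (contMDiffAt_chartFrame p hy v)
  rw [contMDiffAt_totalSpace] at h
  exact h.2.contDiffAt

theorem contDiffOn_oneFormInChart {θ : ∀ x : M, TangentSpace 𝓘(ℝ, Eucl m) x →L[ℝ] ℝ}
    (hθ : ContMDiff 𝓘(ℝ, Eucl m) (𝓘(ℝ, Eucl m).prod 𝓘(ℝ, Eucl m →L[ℝ] ℝ)) ∞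
    (fun x => TotalSpace.mk' (Eucl m →L[ℝ] ℝ)
      (E := fun x : M => TangentSpace 𝓘(ℝ, Eucl m) x →L[ℝ] Bundle.Trivial M ℝ x) x (θ x))) (p : M) :
    ContDiffOn ℝ ∞ (oneFormInChart θ (chartAt (Eucl m) p)) (chartAt (Eucl m) p).target := by
  simp_rw [contDiffOn_clm_apply]
  intro u y hy
  refine ContDiffAt.contDiffWithinAt ?_
  have hs : ContMDiffAt 𝓘(ℝ, Eucl m) 𝓘(ℝ, Eucl m) ∞ (chartAt (Eucl m) p).symm y :=
    (contMDiffOn_chart_symm (I := 𝓘(ℝ, Eucl m)) (n := ∞) (x := p)).contMDiffAt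
      ((chartAt (Eucl m) p).open_target.mem_nhds hy)
  have hθ' : ContMDiffAt 𝓘(ℝ, Eucl m) (𝓘(ℝ, Eucl m).prod 𝓘(ℝ, Eucl m →L[ℝ] ℝ)) ∞
      (fun z => TotalSpace.mk' (Eucl m →L[ℝ] ℝ)
        (E := fun x : M => TangentSpace 𝓘(ℝ, Eucl m) x →L[ℝ] Bundle.Trivial M ℝ x)
        ((chartAt (Eucl m) p).symm z) (θ ((chartAt (Eucl m) p).symm z))) y :=
    hθ.contMDiffAt.comp y hs
  have h := ContMDiffAt.clm_bundle_apply (E₂ := Bundle.Trivial M ℝ) (F₂ := ℝ)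
    hθ' (contMDiffAt_chartFrame p hy u)
  rw [contMDiffAt_totalSpace] at h
  exact h.2.contDiffAt

theorem contDiffOn_endoInChart
    {J : ∀ x : M, TangentSpace 𝓘(ℝ, Eucl m) x →L[ℝ] TangentSpace 𝓘(ℝ, Eucl m) x}
    (hJ : ContMDiff 𝓘(ℝ, Eucl m) (𝓘(ℝ, Eucl m).prod 𝓘(ℝ, Eucl m →L[ℝ] Eucl m)) ∞
    (fun x => TotalSpace.mk' (Eucl m →L[ℝ] Eucl m)
      (E := fun x : M => TangentSpace 𝓘(ℝ, Eucl m) x →L[ℝ] TangentSpace 𝓘(ℝ, Eucl m) x) x (J x)))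
    (p : M) :
    ContDiffOn ℝ ∞ (endoInChart J (chartAt (Eucl m) p)) (chartAt (Eucl m) p).target := by
  simp_rw [contDiffOn_clm_apply]
  intro u y hy
  refine ContDiffAt.contDiffWithinAt ?_
  have hs : ContMDiffAt 𝓘(ℝ, Eucl m) 𝓘(ℝ, Eucl m) ∞ (chartAt (Eucl m) p).symm y :=
    (contMDiffOn_chart_symm (I := 𝓘(ℝ, Eucl m)) (n := ∞) (x := p)).contMDiffAt
      ((chartAt (Eucl m) p).open_target.mem_nhds hy)
  have hJ' : ContMDiffAt 𝓘(ℝ, Eucl m) (𝓘(ℝ, Eucl m).prod 𝓘(ℝ, Eucl m →L[ℝ] Eucl m)) ∞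
      (fun z => TotalSpace.mk' (Eucl m →L[ℝ] Eucl m)
        (E := fun x : M => TangentSpace 𝓘(ℝ, Eucl m) x →L[ℝ] TangentSpace 𝓘(ℝ, Eucl m) x)
        ((chartAt (Eucl m) p).symm z) (J ((chartAt (Eucl m) p).symm z))) y :=
    hJ.contMDiffAt.comp y hs
  have h := ContMDiffAt.clm_bundle_apply (E₂ := (TangentSpace 𝓘(ℝ, Eucl m) : M → Type _))
    (F₂ := Eucl m) hJ' (contMDiffAt_chartFrame p hy u)
  have hys := (chartAt (Eucl m) p).map_target hy
  rw [(trivializationAt (Eucl m) (TangentSpace 𝓘(ℝ, Eucl m) : M → Type _) p).contMDiffAt_iff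
    (by simpa [Trivialization.mem_source] using hys)] at h
  refine (h.2.congr_of_eventuallyEq ?_).contDiffAt
  filter_upwards [(chartAt (Eucl m) p).open_target.mem_nhds hy] with z hz
  have hzs := (chartAt (Eucl m) p).map_target hz
  simp only [endoInChart, ContinuousLinearMap.comp_apply]
  rw [chartCoframe_eq_continuousLinearMapAt p hz,
    Trivialization.continuousLinearMapAt_apply, Trivialization.coe_linearMapAt_of_mem _
    (by simpa using hzs)]
end ChartSmoothness
-- Agreement of the coordinate Ricci tensor with the trace of curvature.
namespace Coord

variable {m : ℕ}

theorem christoffelCLM_apply (G : Eucl m → Eucl m →L[ℝ] Eucl m →L[ℝ] ℝ) (y u v : Eucl m) :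
    christoffelCLM G y u v = christoffel G y u v := by
  rfl

theorem IsMetricOn.riemann_eq_curv {G : Eucl m → Eucl m →L[ℝ] Eucl m →L[ℝ] ℝ} {s : Set (Eucl m)}
    (hG : IsMetricOn G s) {y : Eucl m} (hy : y ∈ s) (u v w : Eucl m) :
    riemann G y u v w = curv (christoffelCLM G) y u v w := by
  have hA := (hG.contDiffAt_christoffel hy).differentiableAt (by simp)
  simp only [riemann, curv, ← christoffelCLM_apply, fderiv_apply_apply hA]

theorem sum_single_eq_trace {f : Eucl m → Eucl m} (hf : IsLinearMap ℝ f) :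
    ∑ i, f (EuclideanSpace.single i 1) i = LinearMap.trace ℝ (Eucl m) hf.mk' := by
  rw [LinearMap.trace_eq_matrix_trace ℝ (EuclideanSpace.basisFun (Fin m) ℝ).toBasis]
  simp [Matrix.trace, LinearMap.toMatrix_apply]

theorem IsMetricOn.ricci_eq_ric {G : Eucl m → Eucl m →L[ℝ] Eucl m →L[ℝ] ℝ} {s : Set (Eucl m)}
    (hG : IsMetricOn G s) {y : Eucl m} (hy : y ∈ s) (v w : Eucl m) :
    ricci G y v w = ric (christoffelCLM G) y v w := by
  simp only [ricci, hG.riemann_eq_curv hy]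
  exact sum_single_eq_trace (isLinearMap_curv (christoffelCLM G) y v w)

end Coord

/-! ### From charts to the manifold. -/

section Global

variable {m : ℕ} {M : Type*} [TopologicalSpace M] [ChartedSpace (Eucl m) M]

theorem bilinInChart_apply
    (b : ∀ x : M, TangentSpace 𝓘(ℝ, Eucl m) x →L[ℝ] TangentSpace 𝓘(ℝ, Eucl m) x →L[ℝ] ℝ)
    (e : OpenPartialHomeomorph M (Eucl m)) (y u v : Eucl m) :
    bilinInChart b e y u v = b (e.symm y) (chartFrame e y u) (chartFrame e y v) := rfl

theorem oneFormInChart_apply (θ : ∀ x : M, TangentSpace 𝓘(ℝ, Eucl m) x →L[ℝ] ℝ)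
    (e : OpenPartialHomeomorph M (Eucl m)) (y u : Eucl m) :
    oneFormInChart θ e y u = θ (e.symm y) (chartFrame e y u) := rfl

variable [IsManifold 𝓘(ℝ, Eucl m) ∞ M]
  {g : ContMDiffRiemannianMetric 𝓘(ℝ, Eucl m) ∞ (Eucl m)
      (TangentSpace 𝓘(ℝ, Eucl m) : M → Type)}
  {J : ∀ x : M, TangentSpace 𝓘(ℝ, Eucl m) x →L[ℝ] TangentSpace 𝓘(ℝ, Eucl m) x}
  {θ : ∀ x : M, TangentSpace 𝓘(ℝ, Eucl m) x →L[ℝ] ℝ}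

theorem chartFrame_endoInChart (p : M) {y : Eucl m} (hy : y ∈ (chartAt (Eucl m) p).target)
    (u : Eucl m) :
    chartFrame (chartAt (Eucl m) p) y (endoInChart J (chartAt (Eucl m) p) y u) =
      J ((chartAt (Eucl m) p).symm y) (chartFrame (chartAt (Eucl m) p) y u) :=
  chartFrame_chartCoframe p hy _

theorem isMetricOn_chartAt (g : ContMDiffRiemannianMetric 𝓘(ℝ, Eucl m) ∞ (Eucl m)
      (TangentSpace 𝓘(ℝ, Eucl m) : M → Type)) (p : M) :
    Coord.IsMetricOn (bilinInChart g.inner (chartAt (Eucl m) p)) (chartAt (Eucl m) p).target where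
  isOpen := (chartAt (Eucl m) p).open_target
  contDiffOn := contDiffOn_bilinInChart g.contMDiff p
  symm y _ u v := by
    rw [bilinInChart_apply, bilinInChart_apply]
    exact g.symm _ _ _
  pos y hy u hu := by
    rw [bilinInChart_apply]
    refine g.pos _ _ fun h => hu ?_
    rw [← chartCoframe_chartFrame p hy u, h, map_zero]

theorem IsNormalizedVaisman.isVaismanOn_chartAt (hV : IsNormalizedVaisman g J θ) (p : M) :
    Coord.IsVaismanOn (bilinInChart g.inner (chartAt (Eucl m) p))
      (endoInChart J (chartAt (Eucl m) p)) (oneFormInChart θ (chartAt (Eucl m) p))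
      (chartAt (Eucl m) p).target := by
  have hatl : chartAt (Eucl m) p ∈ IsManifold.maximalAtlas 𝓘(ℝ, Eucl m) ∞ M :=
    IsManifold.chart_mem_maximalAtlas p
  have hJd : ∀ y ∈ (chartAt (Eucl m) p).target,
      HasFDerivAt (endoInChart J (chartAt (Eucl m) p))
        (fderiv ℝ (endoInChart J (chartAt (Eucl m) p)) y) y := fun y hy =>
    (((contDiffOn_endoInChart hV.smooth_J p).contDiffAt
      ((chartAt (Eucl m) p).open_target.mem_nhds hy)).differentiableAt (by simp)).hasFDerivAt
  refine { isMetricOn_chartAt g p with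
    contDiffOn_J := contDiffOn_endoInChart hV.smooth_J p
    contDiffOn_θ := contDiffOn_oneFormInChart hV.smooth_θ p
    J_sq := ?_, hermitian := ?_, exists_dual := ?_, integrable := ?_, parallel := ?_, lee := ?_ }
  · intro y hy u
    have h := hV.J_sq _ (chartFrame (chartAt (Eucl m) p) y u)
    have h1 := congrArg (chartCoframe (chartAt (Eucl m) p) y) h
    rw [map_neg, chartCoframe_chartFrame p hy] at h1
    rw [← h1, ← chartFrame_endoInChart p hy]
    rfl
  · intro y hy u v
    simp only [bilinInChart_apply, chartFrame_endoInChart p hy]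
    exact hV.hermitian _ _ _
  · intro y hy
    obtain ⟨U, hU, hUU⟩ := hV.norm_θ ((chartAt (Eucl m) p).symm y)
    refine ⟨chartCoframe (chartAt (Eucl m) p) y U, fun v => ?_, ?_⟩
    · rw [bilinInChart_apply, chartFrame_chartCoframe p hy, oneFormInChart_apply, hU]
    · rw [bilinInChart_apply, chartFrame_chartCoframe p hy, hUU]
  · intro y hy u v
    have h := hV.integrable _ hatl y hy u v
    have hJv : ∀ v, HasFDerivAt (fun z => endoInChart J (chartAt (Eucl m) p) z v) _ y := fun v =>
      (hJd y hy).clm_apply (hasFDerivAt_const v y)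
    simp only [Coord.nijenhuis, VectorField.lieBracket, (hJv _).fderiv] at h
    simp at h
    rw [← h]
  · intro y hy u v
    have h := hV.parallel _ hatl y hy u v
    rw [Coord.covDerivOneForm, sub_eq_zero] at h
    exact h
  · intro y hy u v w
    have h := hV.lee _ hatl y hy u v w
    -- The chart frame intertwines J with its coordinate expression, so ω is G(·, J·) in the chart
    -- and its derivative follows from the product rule.
    have hom : ∀ z ∈ (chartAt (Eucl m) p).target, ∀ a b,
        bilinInChart (fundamentalForm g.inner J) (chartAt (Eucl m) p) z a b =
          bilinInChart g.inner (chartAt (Eucl m) p) z a (endoInChart J (chartAt (Eucl m) p) z b) := by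
      intro z hz a b
      simp only [bilinInChart_apply, chartFrame_endoInChart p hz]
      rfl
    have hG := ((isMetricOn_chartAt g p).differentiableAt hy).hasFDerivAt
    have hnhds := (chartAt (Eucl m) p).open_target.mem_nhds hy
    have hsm : ContDiffOn ℝ ∞ (bilinInChart (fundamentalForm g.inner J) (chartAt (Eucl m) p))
        (chartAt (Eucl m) p).target := by
      simp_rw [contDiffOn_clm_apply]
      intro a b
      exact ((((isMetricOn_chartAt g p).contDiffOn).clm_apply contDiffOn_const).clm_apply
        ((contDiffOn_endoInChart hV.smooth_J p).clm_apply contDiffOn_const)).congr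
          fun z hz => hom z hz a b
    have hΩ := ((hsm.contDiffAt hnhds).differentiableAt (by simp)).hasFDerivAt
    have hc : ∀ c : Eucl m, HasFDerivAt (fun _ : Eucl m => c) (0 : Eucl m →L[ℝ] Eucl m) y :=
      fun c => hasFDerivAt_const c y
    have hD : ∀ x a b,
        fderiv ℝ (bilinInChart (fundamentalForm g.inner J) (chartAt (Eucl m) p)) y x a b =
          fderiv ℝ (bilinInChart g.inner (chartAt (Eucl m) p)) y x a
            (endoInChart J (chartAt (Eucl m) p) y b)
          + bilinInChart g.inner (chartAt (Eucl m) p) y a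
            (fderiv ℝ (endoInChart J (chartAt (Eucl m) p)) y x b) := by
      intro x a b
      have h1 := (hΩ.clm_apply (hc a)).clm_apply (hc b)
      have h2 := (hG.clm_apply (hc a)).clm_apply ((hJd y hy).clm_apply (hc b))
      have h3 := h1.unique (h2.congr_of_eventuallyEq (by
        filter_upwards [hnhds] with z hz using hom z hz a b))
      have h4 := congrArg (fun L => L x) h3
      simp at h4
      linarith
    simp only [Coord.extDerivTwoForm, Coord.wedgeOneTwo, hD, hom y hy] at h
    exact h

theorem contDiffOn_comp_chartAt_symm {f : M → ℝ} (hf : ContMDiff 𝓘(ℝ, Eucl m) 𝓘(ℝ, ℝ) ∞ f)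
    (p : M) :
    ContDiffOn ℝ ∞ (f ∘ (chartAt (Eucl m) p).symm) (chartAt (Eucl m) p).target :=
  (hf.comp_contMDiffOn (contMDiffOn_chart_symm (I := 𝓘(ℝ, Eucl m)) (x := p))).contDiffOn

/-- Vanishing derivative gives constancy on a coordinate ball around each point, hence local
constancy; connectedness does the rest. -/
theorem exists_eq_const_of_fderiv_chart_eq_zero [ConnectedSpace M] {f : M → ℝ}
    (hf : ContMDiff 𝓘(ℝ, Eucl m) 𝓘(ℝ, ℝ) ∞ f)
    (h : ∀ p : M, ∀ y ∈ (chartAt (Eucl m) p).target,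
      fderiv ℝ (f ∘ (chartAt (Eucl m) p).symm) y = 0) :
    ∃ c, ∀ x, f x = c := by
  have hloc : IsLocallyConstant f := by
    rw [IsLocallyConstant.iff_eventually_eq]
    intro p
    obtain ⟨ε, hε, hball⟩ := Metric.isOpen_iff.1 (chartAt (Eucl m) p).open_target _
      (mem_chart_target (Eucl m) p)
    have hnhds : (chartAt (Eucl m) p) ⁻¹' Metric.ball (chartAt (Eucl m) p p) ε ∈ nhds p :=
      (chartAt (Eucl m) p).continuousAt (mem_chart_source _ p) |>.preimage_mem_nhds
        (Metric.ball_mem_nhds _ hε)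
    filter_upwards [hnhds, (chartAt (Eucl m) p).open_source.mem_nhds (mem_chart_source _ p)]
      with x hx hxs
    have h1 := Metric.isOpen_ball.is_const_of_fderiv_eq_zero (𝕜 := ℝ)
      (convex_ball (chartAt (Eucl m) p p) ε).isPreconnected
      (((contDiffOn_comp_chartAt_symm hf p).mono hball).differentiableOn (by simp))
      (fun y hy => h p y (hball hy)) hx (Metric.mem_ball_self hε)
    simpa [(chartAt (Eucl m) p).left_inv hxs] using h1
  obtain ⟨p⟩ := (inferInstance : Nonempty M)
  exact ⟨f p, fun x => hloc.apply_eq_of_isPreconnected isPreconnected_univ trivial trivial⟩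

end Global

theorem mainTheorem7 (n : ℕ) (hn : 1 ≤ n) {M : Type*} [TopologicalSpace M] [ConnectedSpace M]
    [ChartedSpace (Eucl (2 * n + 2)) M] [IsManifold 𝓘(ℝ, Eucl (2 * n + 2)) ∞ M]
    (g : ContMDiffRiemannianMetric 𝓘(ℝ, Eucl (2 * n + 2)) ∞ (Eucl (2 * n + 2))
      (TangentSpace 𝓘(ℝ, Eucl (2 * n + 2)) : M → Type))
    (J : ∀ x : M, TangentSpace 𝓘(ℝ, Eucl (2 * n + 2)) x →L[ℝ]
      TangentSpace 𝓘(ℝ, Eucl (2 * n + 2)) x)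
    (θ : ∀ x : M, TangentSpace 𝓘(ℝ, Eucl (2 * n + 2)) x →L[ℝ] ℝ)
    (hV : IsNormalizedVaisman g J θ)
    (lam α β : M → ℝ)
    (hlam : ContMDiff 𝓘(ℝ, Eucl (2 * n + 2)) 𝓘(ℝ, ℝ) ∞ lam)
    (hα : ContMDiff 𝓘(ℝ, Eucl (2 * n + 2)) 𝓘(ℝ, ℝ) ∞ α)
    (hβ : ContMDiff 𝓘(ℝ, Eucl (2 * n + 2)) 𝓘(ℝ, ℝ) ∞ β)
    (hRic : RicciDecomposition g J θ lam α β) :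
    (∀ x, lam x + α x = (n : ℝ) / 2) ∧ (∀ x, β x = -lam x) ∧
      (3 ≤ n → (∃ c : ℝ, ∀ x, lam x = c) ∧ (∃ c : ℝ, ∀ x, α x = c)) := by
  have hdim : Module.finrank ℝ (Eucl (2 * n + 2)) = 2 * n + 2 := by simp
  have hric : ∀ p : M, ∀ z ∈ (chartAt (Eucl (2 * n + 2)) p).target, ∀ v w, _ :=
    fun p z hz v w => ((isMetricOn_chartAt g p).ricci_eq_ric hz v w).symm.trans
      (hRic _ (IsManifold.chart_mem_maximalAtlas p) z hz v w)
  have hanti : ∀ p : M, ∀ z ∈ (chartAt (Eucl (2 * n + 2)) p).target, ∀ v,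
      oneFormInChart (antiLeeForm J θ) (chartAt (Eucl (2 * n + 2)) p) z v =
        oneFormInChart θ (chartAt (Eucl (2 * n + 2)) p) z
          (endoInChart J (chartAt (Eucl (2 * n + 2)) p) z v) := fun p z hz v => by
    rw [oneFormInChart_apply, oneFormInChart_apply, chartFrame_endoInChart p hz]
    rfl
  have hric' : ∀ p : M, ∀ z ∈ (chartAt (Eucl (2 * n + 2)) p).target, ∀ v w, _ :=
    fun p z hz v w => by
      have h := hric p z hz v w
      rw [hanti p z hz, hanti p z hz] at h
      exact h
  -- Each point is examined in its own preferred chart, which suffices for the pointwise equations.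
  have hcoeff := fun p : M => (hV.isVaismanOn_chartAt p).ricci_coeff_of_decomposition
    (lam := lam ∘ (chartAt (Eucl (2 * n + 2)) p).symm)
    (al := α ∘ (chartAt (Eucl (2 * n + 2)) p).symm)
    (be := β ∘ (chartAt (Eucl (2 * n + 2)) p).symm) (hric' p)
    (mem_chart_target (Eucl (2 * n + 2)) p)
  have h1 : ∀ x, lam x + α x = (n : ℝ) / 2 := fun x => by
    have h := (hcoeff x).1
    simp only [Function.comp_apply,
      (chartAt (Eucl (2 * n + 2)) x).left_inv (mem_chart_source _ x), hdim] at h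
    rw [h]; push_cast; ring
  refine ⟨h1, fun x => ?_, fun hn3 => ?_⟩
  · have h := (hcoeff x).2
    simpa only [Function.comp_apply,
      (chartAt (Eucl (2 * n + 2)) x).left_inv (mem_chart_source _ x)] using h
  · obtain ⟨c, hc⟩ := exists_eq_const_of_fderiv_chart_eq_zero hlam fun p y hy =>
      (hV.isVaismanOn_chartAt p).fderiv_eq_zero_of_decomposition (by omega)
        (contDiffOn_comp_chartAt_symm hlam p)
        (al := α ∘ (chartAt (Eucl (2 * n + 2)) p).symm)
        (be := β ∘ (chartAt (Eucl (2 * n + 2)) p).symm) (hric' p) hy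
    exact ⟨⟨c, hc⟩, (n : ℝ) / 2 - c, fun x => by rw [← h1 x, hc x]; ring⟩
end
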